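/- **Polytope numbers.** Let $P\subset\mathbb R^m$ be a polytope and choose for every nonempty face $F$ of $P$ a vertex $\mathbf v_F$ of $F$ (its apex). The polytope numbers $P(n)$ and interior polytope numbers $P(n)^\sharp$, $n\ge 0$, are defined by induction on dimension and $n$. If $\dim P=0$, then $P(0)=P(0)^\sharp=0$ and $P(n)=P(n)^\sharp=1$ for $n\ge1$. If $\dim P\ge1$, then $P(0)=P(0)^\sharp=0$, $P(1)=1$, $P(1)^\sharp=0$, and for $n\ge2$ $$P(n)=P(n-1)+\sum_{\mathbf v_P\notin F}F(n)^\sharp,\qquad P(n)^\sharp=P(n)-\sum_{F\ne P}F(n)^\sharp,$$ the sums being over nonempty faces $F$ of $P$. **Pointed triangulations.** A pointed triangulation of $P$ with apexes $(\mathbf v_F)$ is a triangulation $\mathcal C$ of $P$ (a finite geometric simplicial complex with union $P$) such that: (1) for each nonempty face $F$ of $P$ the simplices of $\mathcal C$ contained in $F$ triangulate $F$, and each maximal one of them contains $\mathbf v_F$; (2) if $\mathbf v_F,\mathbf v_G\in F\cap G$ for two faces $F,G$, then $\mathbf v_F=\mathbf v_G$; (3) for each face $F$ and each vertex $\mathbf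 w\ne\mathbf v_F$ of $F$, the segment $[\mathbf v_F,\mathbf w]$ is an edge of $\mathcal C$; and (4) the apexes are given by a linear form $c$ that takes distinct values at distinct vertices of $P$: $\mathbf v_F$ minimizes $c$ on $F$. Let $\alpha^d(n)$ denote the polytope numbers of the standard $d$-simplex, with any choice of apexes, where $\alpha^d(k)=0$ for $k\le0$. Then the following hold. 1. **Cross polytope.** Let $d\ge1$ and $\beta^d=\mathrm{conv}\{\pm\mathbf e_1,\dots,\pm\mathbf e_d\}\subset\mathbb R^d$. The simplices with vertex sets $\{\mathbf e_d,-\mathbf e_d,a_1\mathbf e_1,\dots,a_{d-1}\mathbf e_{d-1}\}$, $a_i\in\{1,-1\}$, are the maximal simplices of a pointed triangulation of $\beta^d$ (for some choice of apexes). For every choice of apexes of $\beta^d$ (in particular that of this triangulation) and every $n\ge0$, $$\beta^d(n)=\sum_{i=0}^{d-1}\binom{d-1}{i}\,\alpha^d(n-i).$$ 2. **Measure polytope.** Let $d\ge1$ and $\gamma^d=\prod_{i=1}^d[a_i,b_i]$ with $a_i<b_i$ (for instance $[0,1]^d$ or $[-1,1]^d$). For a permutation $\sigma$ of $\{1,\dots,d\}$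 let $\mathbf v_k^\sigma$, $0\le k\le d$, be the vertex of $\gamma^d$ whose $j$-th coordinate is $b_j$ for $j\in\{\sigma(1),\dots,\sigma(k)\}$ and $a_j$ otherwise. The simplices with vertex sets $\{\mathbf v_0^\sigma,\dots,\mathbf v_d^\sigma\}$ are the maximal simplices of a pointed triangulation of $\gamma^d$ (for some choice of apexes). For every choice of apexes of $\gamma^d$ and every $n\ge0$, $$\gamma^d(n)=\sum_{i=0}^{d-1}\left\langle{d\atop i}\right\rangle\alpha^d(n-i),$$ where the Eulerian number $\left\langle{d\atop i}\right\rangle$ is the number of permutations of $\{1,\dots,d\}$ with exactly $i$ descents. 3. **Products of simplices.** Let $d_1,\dots,d_l\ge0$ be integers with $d=d_1+\dots+d_l\ge1$, and let $\alpha^{d_1,\dots,d_l}=\prod_{j=1}^l\alpha^{d_j}$, where $\alpha^{d_j}$ is the standard simplex with vertices $\mathbf e^j_0,\dots,\mathbf e^j_{d_j}$ in $\mathbb R^{d_j+1}$. For a permutation $w=[w_1,\dots,w_d]$ of the multiset $\{1^{d_1},\dots,l^{d_l}\}$ and $0\le i\le d$ let $\mathbf v^w_i=(\mathbf e^1_{A^1_i},\dots,\mathbf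 e^l_{A^l_i})$, where $A^j_i=|\{k\le i: w_k=j\}|$. The simplices with vertex sets $\{\mathbf v^w_0,\dots,\mathbf v^w_d\}$ are the maximal simplices of a pointed triangulation of $\alpha^{d_1,\dots,d_l}$ (for some choice of apexes). For every choice of apexes of $\alpha^{d_1,\dots,d_l}$ and every $n\ge0$, $$\alpha^{d_1,\dots,d_l}(n)=\sum_{i=0}^{d-1}\left\langle{d_1,\dots,d_l\atop i}\right\rangle\alpha^d(n-i),$$ where the generalized Eulerian number $\left\langle{d_1,\dots,d_l\atop i}\right\rangle$ is the number of permutations $w$ of the multiset $\{1^{d_1},\dots,l^{d_l}\}$ with exactly $i$ descents, i.e. with exactly $i$ indices $k$ such that $w_k>w_{k+1}$. -/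

import Mathlib

open Finset

section Faces

variable {E : Type*} [AddCommGroup E] [Module ℝ E] [TopologicalSpace E]

/-- The dimension of a (nonempty) polytope: the dimension of its affine hull. -/
noncomputable def polytopeDim (P : Set E) : ℕ := Module.finrank ℝ (vectorSpan ℝ P)

/-- `F` is a nonempty face of `P`: the set of maximizers on `P` of some linear form
(the zero form gives `P` itself). -/
def IsFace (P F : Set E) : Prop := IsExposed ℝ P F ∧ F.Nonempty

/-- A nonempty face of `P` other than `P`. -/
def IsProperFace (P F : Set E) : Prop := IsFace P F ∧ F ≠ P

/-- `V` designates for every nonempty face `F` of `P` a vertex `V F` of `F`, the apex of `F`. -/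
def IsApexAssignment (P : Set E) (V : Set E → E) : Prop :=
  ∀ F, IsFace P F → V F ∈ F.extremePoints ℝ

theorem polytopeDim_lt_of_isProperFace [FiniteDimensional ℝ E] {P F : Set E}
    (h : IsProperFace P F) : polytopeDim F < polytopeDim P := by
  obtain ⟨⟨hexp, hne⟩, hFP⟩ := h
  have hsub : F ⊆ P := hexp.subset
  obtain ⟨l, hl⟩ := hexp hne
  obtain ⟨x₀, hx₀⟩ := hne
  have hx₀' := hx₀
  rw [hl] at hx₀'
  obtain ⟨y, hyP, hyF⟩ := Set.exists_of_ssubset (hsub.ssubset_of_ne hFP)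
  apply Submodule.finrank_lt_finrank_of_lt
  refine lt_of_le_of_ne (vectorSpan_mono ℝ hsub) fun heq => ?_
  have hker : vectorSpan ℝ F ≤ LinearMap.ker (l : E →ₗ[ℝ] ℝ) := by
    rw [vectorSpan_def, Submodule.span_le]
    rintro _ ⟨a, ha, b, hb, rfl⟩
    rw [hl] at ha hb
    have h1 := ha.2 b hb.1
    have h2 := hb.2 a ha.1
    simp only [SetLike.mem_coe, LinearMap.mem_ker, vsub_eq_sub, map_sub,
      ContinuousLinearMap.coe_coe]
    linarith
  have hmem : y -ᵥ x₀ ∈ vectorSpan ℝ F :=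
    heq ▸ vsub_mem_vectorSpan ℝ hyP (hsub hx₀)
  have h0 := hker hmem
  simp only [LinearMap.mem_ker, vsub_eq_sub, map_sub, ContinuousLinearMap.coe_coe] at h0
  apply hyF
  rw [hl]
  refine ⟨hyP, fun z hz => ?_⟩
  have h3 := hx₀'.2 z hz
  linarith

end Faces

section PolytopeNumbers

open Classical in
/-- The pair `(P(n), P(n)^♯)` of the `n`-th polytope number and the `n`-th interior polytope
number of `P` with respect to the apexes `V`, by double induction on `dim P` and `n`.
* `dim P = 0`: both sequences are `0, 1, 1, 1, …`.
* `dim P ≥ 1`: `P(0) = 0`, `P(1) = 1`, `P(0)^♯ = P(1)^♯ = 0`, and for `n ≥ 2`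
  `P(n) = P(n - 1) + ∑ F(n)^♯` over the faces `F` of `P` that do not contain the apex of `P`
  (all of them proper faces), `P(n)^♯ = P(n) - ∑ F(n)^♯` over all proper faces `F` of `P`. -/
noncomputable def polytopeNumberPair {E : Type*} [AddCommGroup E] [Module ℝ E] [TopologicalSpace E]
    [FiniteDimensional ℝ E] (V : Set E → E) (P : Set E)
    (n : ℕ) : ℤ × ℤ :=
  if polytopeDim P = 0 then
    (if n = 0 then (0, 0) else (1, 1))
  else match n with
    | 0 => (0, 0)
    | 1 => (1, 0)
    | m + 2 =>
      let N : ℤ := (polytopeNumberPair V P (m + 1)).1 +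
        ∑ᶠ F : {F : Set E // IsProperFace P F},
          if V P ∈ F.1 then 0 else (polytopeNumberPair V F.1 (m + 2)).2
      (N, N - ∑ᶠ F : {F : Set E // IsProperFace P F}, (polytopeNumberPair V F.1 (m + 2)).2)
termination_by (polytopeDim P, n)
decreasing_by
  · exact Prod.Lex.right _ (Nat.lt_succ_self _)
  · exact Prod.Lex.left _ _ (polytopeDim_lt_of_isProperFace F.2)
  · exact Prod.Lex.left _ _ (polytopeDim_lt_of_isProperFace F.2)

/-- The polytope number `P(n)` with respect to the apexes `V`. -/
noncomputable def polytopeNumber {E : Type*} [AddCommGroup E] [Module ℝ E] [TopologicalSpace E]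
    [FiniteDimensional ℝ E] (V : Set E → E) (P : Set E)
    (n : ℕ) : ℤ :=
  (polytopeNumberPair V P n).1

/-- The triangulation `K` of the polytope `P` is a pointed triangulation with apexes `V`. -/
structure IsPointedTriangulation {E : Type*} [AddCommGroup E] [Module ℝ E]
    [TopologicalSpace E] (P : Set E) (V : Set E → E)
    (K : Geometry.SimplicialComplex ℝ E) : Prop where
  finite_faces : K.faces.Finite
  /-- `K` is a triangulation of `P`. -/
  space_eq : K.space = P
  /-- The apex of each face is a vertex of that face. -/
  apex : IsApexAssignment P V
  /-- The simplices of `K` lying in a face `F` triangulate `F`. -/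
  face_space : ∀ F, IsFace P F → ∀ x ∈ F, ∃ s ∈ K.faces,
    convexHull ℝ (s : Set E) ⊆ F ∧ x ∈ convexHull ℝ (s : Set E)
  /-- Every maximal simplex of the triangulation of a face `F` (these are its simplices of
  dimension `dim F`) contains the apex of `F`. -/
  apex_mem : ∀ F, IsFace P F → ∀ s ∈ K.faces, convexHull ℝ (s : Set E) ⊆ F →
    (∀ t ∈ K.faces, convexHull ℝ (t : Set E) ⊆ F → s ⊆ t → t = s) → V F ∈ s
  /-- Two faces whose apexes both lie in both faces have the same apex. -/
  apex_eq : ∀ F G, IsFace P F → IsFace P G → V F ∈ F ∩ G → V G ∈ F ∩ G → V F = V G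
  /-- In each face the segment from the apex to any other vertex is an edge of `K`. -/
  edge : ∀ F, IsFace P F → ∀ w ∈ F.extremePoints ℝ, w ≠ V F →
    ∃ s ∈ K.faces, (s : Set E) = {V F, w}
  /-- The apexes come from a linear form in general position, that is, one that separates the
  vertices of `P`: the apex of a face minimizes the form on that face. -/
  linear_form : ∃ c : E →ₗ[ℝ] ℝ, Set.InjOn c (P.extremePoints ℝ) ∧
    ∀ F, IsFace P F → ∀ x ∈ F, c (V F) ≤ c x

end PolytopeNumbers

section Polytopes

/-- The standard `d`-cross polytope, the convex hull of `±e_1, …, ±e_d` in `ℝ^d`. -/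
def crossPolytope (d : ℕ) : Set (Fin d → ℝ) :=
  convexHull ℝ (Set.range (fun i => Pi.single i 1) ∪ Set.range (fun i => -Pi.single i 1))

/-- For signs `a_1, …, a_d`, the vertex set `{e_{d+1}, -e_{d+1}, a_1 e_1, …, a_d e_d}` in
`ℝ^{d+1}`. -/
noncomputable def crossSimplex {d : ℕ} (a : Fin d → ℤˣ) : Finset (Fin (d + 1) → ℝ) :=
  {Pi.single (Fin.last d) 1, -Pi.single (Fin.last d) 1} ∪
    univ.image fun i => Pi.single i.castSucc ((a i : ℤ) : ℝ)

/-- The product of the segments `[a_i, b_i]`; the `d`-measure polytopes are these with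
`a_i < b_i` for all `i`. -/
def measurePolytope {d : ℕ} (a b : Fin d → ℝ) : Set (Fin d → ℝ) :=
  Set.univ.pi fun i => Set.Icc (a i) (b i)

/-- For a permutation `σ`, the vertex set `v_0, v_1, …, v_d` of vertices of the measure polytope, where
`v_0 = a` and `v_{k+1}` is obtained from `v_k` by changing coordinate `σ k` from its value in `a`
to its value in `b`. For `a = 0`, `b = 1` this is
`v_k = e_{σ 0} + ⋯ + e_{σ (k-1)}`. -/
noncomputable def boxSimplex {d : ℕ} (a b : Fin d → ℝ) (σ : Equiv.Perm (Fin d)) :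
    Finset (Fin d → ℝ) :=
  univ.image fun k : Fin (d + 1) => fun j => if (σ.symm j : ℕ) < k then b j else a j

/-- The product of the standard simplices of dimensions `d_1, …, d_l`, where the standard
`m`-simplex lies in `ℝ^{m+1}`. -/
def simplexProduct {l : ℕ} (d : Fin l → ℕ) : Set ((j : Fin l) → Fin (d j + 1) → ℝ) :=
  Set.univ.pi fun j => stdSimplex ℝ (Fin (d j + 1))

/-- `w` is a permutation of the multiset in which `j` has multiplicity `d j`. -/
def IsMultisetPerm {l : ℕ} (d : Fin l → ℕ) (w : Fin (∑ j, d j) → Fin l) : Prop :=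
  ∀ j, #{k | w k = j} = d j

/-- The vertex set `v_0, v_1, …, v_d` (`d = d_1 + ⋯ + d_l`) of vertices of the product of
simplices, where the `j`-th component of `v_i` is the unit vector of index
`A = #{k < i : w k = j}`. -/
noncomputable def productSimplex {l : ℕ} (d : Fin l → ℕ) (w : Fin (∑ j, d j) → Fin l) :
    Finset ((j : Fin l) → Fin (d j + 1) → ℝ) :=
  univ.image fun i : Fin ((∑ j, d j) + 1) => fun j m =>
    if (m : ℕ) = #{k : Fin (∑ j, d j) | (k : ℕ) < i ∧ w k = j} then 1 else 0

end Polytopes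

section Eulerian

/-- The number of descents of a word, i.e. of indices `k` with `w k > w (k + 1)`. -/
def descentCount {m l : ℕ} (w : Fin m → Fin l) : ℕ :=
  #{p : Fin m × Fin m | (p.2 : ℕ) = p.1 + 1 ∧ w p.2 < w p.1}

/-- The Eulerian number: the number of permutations of `d` letters with `i` descents. -/
def eulerianNumber (d i : ℕ) : ℕ :=
  #{σ : Equiv.Perm (Fin d) | descentCount σ = i}

open Classical in
/-- The generalized Eulerian number: the number of permutations of the multiset
`{1^{d_1}, …, l^{d_l}}` with `i` descents. -/
noncomputable def generalizedEulerianNumber {l : ℕ} (d : Fin l → ℕ) (i : ℕ) : ℕ :=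
  #{w : Fin (∑ j, d j) → Fin l | IsMultisetPerm d w ∧ descentCount w = i}

end Eulerian

/-!
A nonempty face of a product of simplices is the product of one nonempty set of vertices from each
factor, so the recursion defining polytope numbers can be solved along the faces: by Vandermonde's
identity, `P(n)` is a product of multiset coefficients and `P(n + 2)^♯` a product of binomial
coefficients, whatever the apexes are. Sorting multiset-valued words by their descents
(MacMahon's form of Worpitzky's identity) turns the product of multiset coefficients into the
generalized Eulerian sum. Boxes are products of segments. Every proper face of the cross polytope
is a simplex, given by a nonzero sign vector, and the increments of the polytope numbers count sign
vectors weighted by a binomial coefficient in the size of the support, that is, they are Delannoy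
numbers.

The simplices of the triangulations are the chains in the product order of the vertices,
respectively the sets of vertices of the cross polytope that contain no antipodal pair other than
`±e_d`. Every point of the polytope has exactly one expression as a convex combination of a
chain (the northwest corner rule), respectively of such a set, which is why they form a simplicial
complex. The apex of a face is its minimizer of a suitable linear form: for a product it is the
least vertex of the face, because a face containing the vertices `a` and `b` also contains
`a ⊓ b` and `a ⊔ b`, whose midpoint is that of `a` and `b`.
-/

section Faces

variable {E : Type*} [AddCommGroup E] [Module ℝ E]

/-- Nonnegative weights on the index type of a family that vanish outside the finite set `C`. -/
structure IsWeightOn {X : Type*} (C : Finset X) (μ : X → ℝ) : Prop where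
  nonneg : 0 ≤ μ
  eq_zero : ∀ a ∉ C, μ a = 0

theorem IsWeightOn.mem {X : Type*} {C : Finset X} {μ : X → ℝ} (hμ : IsWeightOn C μ) {a : X}
    (ha : μ a ≠ 0) : a ∈ C :=
  by_contra fun h => ha (hμ.eq_zero a h)

theorem isWeightOn_univ {X : Type*} [Fintype X] {μ : X → ℝ} : IsWeightOn univ μ ↔ 0 ≤ μ :=
  ⟨IsWeightOn.nonneg, fun h => ⟨h, fun a ha => (ha (mem_univ a)).elim⟩⟩

theorem mem_convexHull_image_iff {X : Type*} [Fintype X] {v : X → E} {C : Finset X} {x : E} :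
    x ∈ convexHull ℝ (v '' C) ↔
      ∃ μ, IsWeightOn C μ ∧ ∑ a, μ a = 1 ∧ ∑ a, μ a • v a = x := by
  classical
  constructor
  · intro hx
    refine convexHull_min (t := {x | ∃ μ, IsWeightOn C μ ∧ ∑ a, μ a = 1 ∧ ∑ a, μ a • v a = x})
      ?_ ?_ hx
    · rintro _ ⟨a, ha, rfl⟩
      refine ⟨Pi.single a 1, ⟨Pi.single_nonneg.2 zero_le_one, fun b hb => ?_⟩, by simp, ?_⟩
      · exact Pi.single_eq_of_ne (by rintro rfl; exact hb ha) _
      · simp [Pi.single_apply, ite_smul]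
    · rintro _ ⟨μ, hμ, hμ1, rfl⟩ _ ⟨ν, hν, hν1, rfl⟩ s t hs ht hst
      refine ⟨s • μ + t • ν, ⟨?_, fun a ha => ?_⟩, ?_, ?_⟩
      · exact add_nonneg (smul_nonneg hs hμ.nonneg) (smul_nonneg ht hν.nonneg)
      · simp [hμ.eq_zero a ha, hν.eq_zero a ha]
      · simp [sum_add_distrib, ← mul_sum, hμ1, hν1, hst]
      · simp [sum_add_distrib, add_smul, smul_sum, smul_smul]
  · rintro ⟨μ, hμ, hμ1, rfl⟩
    have hzero : ∀ a ∈ univ, a ∉ C → μ a = 0 := fun a _ => hμ.eq_zero a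
    rw [← sum_subset (subset_univ C) fun a ha haC => by rw [hzero a ha haC, zero_smul]]
    rw [← sum_subset (subset_univ C) hzero] at hμ1
    exact (convex_convexHull ℝ _).sum_mem (fun a _ => hμ.nonneg a) hμ1 fun a ha =>
      subset_convexHull ℝ _ ⟨a, ha, rfl⟩

theorem mem_convexHull_range_iff {X : Type*} [Fintype X] {v : X → E} {x : E} :
    x ∈ convexHull ℝ (Set.range v) ↔
      ∃ μ : X → ℝ, 0 ≤ μ ∧ ∑ a, μ a = 1 ∧ ∑ a, μ a • v a = x := by
  rw [← Set.image_univ, ← coe_univ, mem_convexHull_image_iff]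
  simp only [isWeightOn_univ]

theorem mem_extremePoints_of_forall_lt {F : Set E} {c : E →ₗ[ℝ] ℝ} {z : E} (hz : z ∈ F)
    (hlt : ∀ x ∈ F, x ≠ z → c z < c x) : z ∈ F.extremePoints ℝ := by
  have hle : ∀ x ∈ F, c z ≤ c x := fun x hx => by
    rcases eq_or_ne x z with rfl | hne
    exacts [le_rfl, (hlt x hx hne).le]
  refine ⟨hz, ?_⟩
  rintro x hx y hy ⟨s, t, hs, ht, hst, hxy⟩
  by_contra hne
  have hcz : c z = s * c x + t * c y := by simp [← hxy]
  have hx' : s * c z < s * c x := by gcongr; exact hlt x hx hne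
  have hy' : t * c z ≤ t * c y := by gcongr; exact hle y hy
  linarith [show s * c z + t * c z = c z by rw [← add_mul, hst, one_mul]]

theorem setOf_forall_le_eq_of_isGreatest {α : Type*} {A : Set α} {l : α → ℝ} {M : ℝ}
    (h : IsGreatest (l '' A) M) : {x ∈ A | ∀ y ∈ A, l y ≤ l x} = {x ∈ A | l x = M} := by
  obtain ⟨⟨z, hz, rfl⟩, hM⟩ := h
  ext x
  exact and_congr_right fun hx =>
    ⟨fun hmax => (hM ⟨x, hx, rfl⟩).antisymm (hmax z hz), fun hxz y hy => hxz ▸ hM ⟨y, hy, rfl⟩⟩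

variable [TopologicalSpace E] {P F : Set E}

theorem isFace_refl (hP : P.Nonempty) : IsFace P P :=
  ⟨IsExposed.refl P, hP⟩

theorem IsFace.extremePoints_subset (hF : IsFace P F) :
    F.extremePoints ℝ ⊆ P.extremePoints ℝ :=
  hF.1.isExtreme.extremePoints_subset_extremePoints

theorem IsFace.mem_of_sum_mem {X : Type*} [Fintype X] (hF : IsFace P F) {v : X → E}
    (hv : ∀ x, v x ∈ P) {μ : X → ℝ} (hμ : 0 ≤ μ) (hμ1 : ∑ x, μ x = 1)
    (hmem : ∑ x, μ x • v x ∈ F) {a : X} (ha : μ a ≠ 0) : v a ∈ F := by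
  obtain ⟨l, rfl⟩ := hF.1 hF.2
  set z := ∑ x, μ x • v x with hz
  have hsum : ∑ x, μ x * (l z - l (v x)) = 0 := by
    simp only [mul_sub, sum_sub_distrib, ← sum_mul, hμ1, one_mul]
    simp [hz]
  rw [sum_eq_zero_iff_of_nonneg
    fun x _ => mul_nonneg (hμ x) (sub_nonneg.2 (hmem.2 _ (hv x)))] at hsum
  have hla : l z - l (v a) = 0 := (mul_eq_zero.1 (hsum a (mem_univ a))).resolve_left ha
  exact ⟨hv a, fun y hy => (hmem.2 y hy).trans (sub_eq_zero.1 hla).le⟩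

theorem IsFace.mem_of_add_eq_add (hF : IsFace P F) {x y z w : E} (hx : x ∈ P) (hy : y ∈ P)
    (hz : z ∈ F) (hw : w ∈ F) (hxy : x + y = z + w) : x ∈ F := by
  obtain ⟨l, rfl⟩ := hF.1 hF.2
  refine ⟨hx, fun u hu => ?_⟩
  have hl : l x + l y = l z + l w := by rw [← map_add, hxy, map_add]
  linarith [hz.2 u hu, hw.2 y hy]

/-- `v a` is the only minimizer of the linear form `c` among the points of the family `v` that lie
in `F`; apexes are chosen in this way. -/
def IsMinVertex {X : Type*} (v : X → E) (c : E →ₗ[ℝ] ℝ) (F : Set E) (a : X) : Prop :=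
  v a ∈ F ∧ ∀ b, v b ∈ F → b ≠ a → c (v a) < c (v b)

variable {X : Type*} [Finite X] {v : X → E} {c : E →ₗ[ℝ] ℝ} {a : X}

theorem IsFace.exists_isMinVertex (hF : IsFace (convexHull ℝ (Set.range v)) F)
    (hc : Function.Injective (c ∘ v)) : ∃ a, IsMinVertex v c F a := by
  classical
  cases nonempty_fintype X
  obtain ⟨x, hx⟩ := hF.2
  obtain ⟨μ, hμ, hμ1, rfl⟩ := mem_convexHull_range_iff.1 (hF.1.subset hx)
  obtain ⟨b, -, hb⟩ := exists_ne_zero_of_sum_ne_zero (hμ1.trans_ne one_ne_zero)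
  have hbF : v b ∈ F :=
    hF.mem_of_sum_mem (fun x => subset_convexHull ℝ _ (Set.mem_range_self x)) hμ hμ1 hx hb
  obtain ⟨a, ha, hmin⟩ := exists_min_image {b | v b ∈ F} (c ∘ v) ⟨b, by simpa using hbF⟩
  exact ⟨a, by simpa using ha, fun b hb hba =>
    (hmin b (by simpa using hb)).lt_of_ne fun h => hba (hc h).symm⟩

theorem IsMinVertex.apply_lt_apply (ha : IsMinVertex v c F a)
    (hF : IsFace (convexHull ℝ (Set.range v)) F) {x : E} (hx : x ∈ F) (hxa : x ≠ v a) :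
    c (v a) < c x := by
  cases nonempty_fintype X
  obtain ⟨μ, hμ, hμ1, rfl⟩ := mem_convexHull_range_iff.1 (hF.1.subset hx)
  have hlt : ∀ b, μ b ≠ 0 → b ≠ a → μ b * c (v a) < μ b * c (v b) := fun b hb hba =>
    mul_lt_mul_of_pos_left (ha.2 b (hF.mem_of_sum_mem
      (fun x => subset_convexHull ℝ _ (Set.mem_range_self x)) hμ hμ1 hx hb) hba)
      ((hμ b).lt_of_ne' hb)
  obtain ⟨b, hb, hba⟩ : ∃ b, μ b ≠ 0 ∧ b ≠ a := by
    by_contra! hμa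
    have hv : ∀ b, μ b • v b = μ b • v a := fun b => by
      by_cases hb : μ b = 0
      · simp [hb]
      · rw [hμa b hb]
    exact hxa (by simp only [hv, ← sum_smul, hμ1, one_smul])
  calc c (v a) = ∑ b, μ b * c (v a) := by rw [← sum_mul, hμ1, one_mul]
    _ < ∑ b, μ b * c (v b) := by
        refine sum_lt_sum (fun b _ => ?_) ⟨b, mem_univ b, hlt b hb hba⟩
        rcases eq_or_ne b a with rfl | hba
        · rfl
        · by_cases hb : μ b = 0
          · simp [hb]
          · exact (hlt b hb hba).le
    _ = c (∑ b, μ b • v b) := by simp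

theorem IsMinVertex.apply_le_apply (ha : IsMinVertex v c F a)
    (hF : IsFace (convexHull ℝ (Set.range v)) F) {x : E} (hx : x ∈ F) : c (v a) ≤ c x := by
  rcases eq_or_ne x (v a) with rfl | hxa
  exacts [le_rfl, (ha.apply_lt_apply hF hx hxa).le]

theorem IsMinVertex.mem_extremePoints (ha : IsMinVertex v c F a)
    (hF : IsFace (convexHull ℝ (Set.range v)) F) : v a ∈ F.extremePoints ℝ :=
  mem_extremePoints_of_forall_lt ha.1 fun _ hx => ha.apply_lt_apply hF hx

end Faces

section Triangulations

variable {E X : Type*} [AddCommGroup E] [Module ℝ E] [Fintype X]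

/-- Weights on members of `𝒞` are determined by their sum and their weighted sum of the points
`v a`. -/
def HasUniqueWeights (v : X → E) (𝒞 : Set (Finset X)) : Prop :=
  ∀ C ∈ 𝒞, ∀ D ∈ 𝒞, ∀ μ ν, IsWeightOn C μ → IsWeightOn D ν →
    ∑ a, μ a = ∑ a, ν a → ∑ a, μ a • v a = ∑ a, ν a • v a → μ = ν

/-- The convex hulls of the sets `v '' C`, `C ∈ 𝒞`, form a triangulation of the convex hull of
all points `v a`, expressed through weights: every point is a weighted mean of `v` for exactly one
weight on a member of `𝒞`. -/
structure IsTriangulationFamily (v : X → E) (𝒞 : Set (Finset X)) : Prop where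
  isLowerSet : IsLowerSet 𝒞
  singleton_mem : ∀ a, {a} ∈ 𝒞
  hasUniqueWeights : HasUniqueWeights v 𝒞
  exists_weight : ∀ x ∈ convexHull ℝ (Set.range v), ∃ C ∈ 𝒞, ∃ μ, IsWeightOn C μ ∧
    ∑ a, μ a = 1 ∧ ∑ a, μ a • v a = x

variable {v : X → E} {𝒞 : Set (Finset X)}

theorem HasUniqueWeights.eq_zero (hu : HasUniqueWeights v 𝒞) {C : Finset X} (hC : C ∈ 𝒞)
    {f : X → ℝ} (hfC : ∀ a ∉ C, f a = 0) (hf : ∑ a, f a = 0) (hfv : ∑ a, f a • v a = 0) :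
    f = 0 := by
  have hpos : IsWeightOn C fun a => (f a)⁺ :=
    ⟨fun a => posPart_nonneg _, fun a ha => by simp [hfC a ha]⟩
  have hneg : IsWeightOn C fun a => (f a)⁻ :=
    ⟨fun a => negPart_nonneg _, fun a ha => by simp [hfC a ha]⟩
  have heq := hu C hC C hC _ _ hpos hneg
    (by rw [← sub_eq_zero, ← sum_sub_distrib]; simpa using hf)
    (by rw [← sub_eq_zero, ← sum_sub_distrib]; simpa [← sub_smul] using hfv)
  funext a
  rw [← posPart_sub_negPart (f a), Pi.zero_apply, sub_eq_zero]
  exact congrFun heq a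

theorem HasUniqueWeights.affineIndependent (hu : HasUniqueWeights v 𝒞) {C : Finset X}
    (hC : C ∈ 𝒞) : AffineIndependent ℝ (fun a : C => v a) := by
  classical
  rw [affineIndependent_iff_of_fintype]
  intro w hw hwv a
  rw [weightedVSub_eq_linear_combination _ hw] at hwv
  let f : X → ℝ := fun a => if h : a ∈ C then w ⟨a, h⟩ else 0
  have hfC : ∀ a ∉ C, f a = 0 := fun a ha => dif_neg ha
  have hf : ∀ a : C, f a = w a := fun a => dif_pos a.2
  have hf0 : f = 0 := by
    refine hu.eq_zero hC hfC ?_ ?_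
    · rw [← hw, ← sum_subset (subset_univ C) fun a _ => hfC a, ← sum_coe_sort]
      simp only [hf]
    · rw [← hwv, ← sum_subset (subset_univ C) fun a _ ha => by rw [hfC a ha, zero_smul],
        ← sum_coe_sort]
      simp only [hf]
  rw [← hf, hf0, Pi.zero_apply]

namespace IsTriangulationFamily

theorem injective (h : IsTriangulationFamily v 𝒞) : v.Injective := by
  classical
  intro a b hab
  have hsingle : ∀ x : X, IsWeightOn {x} (Pi.single x (1 : ℝ)) := fun x =>
    ⟨Pi.single_nonneg.2 zero_le_one, fun y hy => Pi.single_eq_of_ne (by simpa using hy) _⟩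
  have heq := h.hasUniqueWeights _ (h.singleton_mem a) _ (h.singleton_mem b) _ _ (hsingle a)
    (hsingle b) (by simp) (by simpa [Pi.single_apply, ite_smul] using hab)
  by_contra hne
  simpa [Pi.single_apply, hne] using congrFun heq a

variable [DecidableEq E]

/-- The simplicial complex whose simplices have the vertex sets `v '' C`, `C ∈ 𝒞` nonempty. -/
def complex (h : IsTriangulationFamily v 𝒞) : Geometry.SimplicialComplex ℝ E where
  faces := {s | ∃ C ∈ 𝒞, C.Nonempty ∧ C.image v = s}
  isRelLowerSet_faces := by
    rintro _ ⟨C, hC, hne, rfl⟩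
    refine ⟨hne.image v, fun t ht htne => ?_⟩
    obtain ⟨D, hD, rfl⟩ := subset_image_iff.1 ht
    exact ⟨D, h.isLowerSet (by simpa using hD) hC, image_nonempty.1 htne, rfl⟩
  indep := by
    rintro _ ⟨C, hC, -, rfl⟩
    refine (h.hasUniqueWeights.affineIndependent hC).range.mono fun x hx => ?_
    obtain ⟨a, ha, rfl⟩ := mem_image.1 (mem_coe.1 hx)
    exact ⟨⟨a, ha⟩, rfl⟩
  inter_subset_convexHull := by
    classical
    rintro _ _ ⟨C, hC, -, rfl⟩ ⟨D, hD, -, rfl⟩ x ⟨hxC, hxD⟩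
    rw [coe_image, mem_convexHull_image_iff] at hxC hxD
    obtain ⟨μ, hμ, hμ1, hμx⟩ := hxC
    obtain ⟨ν, hν, hν1, hνx⟩ := hxD
    obtain rfl : μ = ν := h.hasUniqueWeights C hC D hD μ ν hμ hν (hμ1.trans hν1.symm)
      (hμx.trans hνx.symm)
    rw [← coe_inter, ← image_inter _ _ h.injective, coe_image, mem_convexHull_image_iff]
    refine ⟨μ, ⟨hμ.nonneg, fun a ha => ?_⟩, hμ1, hμx⟩
    rw [mem_inter, not_and_or] at ha
    exact ha.elim (hμ.eq_zero a) (hν.eq_zero a)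

variable (h : IsTriangulationFamily v 𝒞)
include h

theorem finite_faces_complex : h.complex.faces.Finite :=
  (Set.finite_range fun C : Finset X => C.image v).subset fun _ ⟨C, _, _, hs⟩ => ⟨C, hs⟩

theorem facets_complex :
    h.complex.facets = {s | ∃ C, Maximal (· ∈ 𝒞) C ∧ C.Nonempty ∧ C.image v = s} := by
  ext s
  constructor
  · rintro ⟨⟨C, hC, hne, rfl⟩, hmax⟩
    refine ⟨C, ⟨hC, fun D hD hCD => ?_⟩, hne, rfl⟩
    exact (image_injective h.injective
      (hmax ⟨D, hD, hne.mono hCD, rfl⟩ (image_subset_image hCD))).ge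
  · rintro ⟨C, hC, hne, rfl⟩
    refine ⟨⟨C, hC.prop, hne, rfl⟩, ?_⟩
    rintro _ ⟨D, hD, -, rfl⟩ hCD
    rw [hC.eq_of_le hD ((image_subset_image_iff h.injective).1 hCD)]

variable [TopologicalSpace E] {F : Set E}

theorem exists_simplex_of_mem_face (hF : IsFace (convexHull ℝ (Set.range v)) F) {x : E}
    (hx : x ∈ F) : ∃ s ∈ h.complex.faces,
      convexHull ℝ (s : Set E) ⊆ F ∧ x ∈ convexHull ℝ (s : Set E) := by
  classical
  obtain ⟨C, hC, μ, hμ, hμ1, rfl⟩ := h.exists_weight x (hF.1.subset hx)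
  obtain ⟨a, -, ha⟩ := exists_ne_zero_of_sum_ne_zero (hμ1.trans_ne one_ne_zero)
  have hsupp : {a ∈ C | μ a ≠ 0} ∈ 𝒞 := h.isLowerSet (filter_subset _ C) hC
  refine ⟨_, ⟨_, hsupp, ⟨a, mem_filter.2 ⟨hμ.mem ha, ha⟩⟩, rfl⟩, ?_, ?_⟩
  · rw [coe_image]
    refine convexHull_min ?_ (hF.1.convex (convex_convexHull ℝ _))
    rintro _ ⟨b, hb, rfl⟩
    exact hF.mem_of_sum_mem (fun x => subset_convexHull ℝ _ (Set.mem_range_self x)) hμ.nonneg hμ1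
      hx (mem_filter.1 hb).2
  · rw [coe_image, mem_convexHull_image_iff]
    refine ⟨μ, ⟨hμ.nonneg, fun b hb => ?_⟩, hμ1, rfl⟩
    by_contra hμb
    exact hb (mem_filter.2 ⟨hμ.mem hμb, hμb⟩)

theorem space_complex : h.complex.space = convexHull ℝ (Set.range v) := by
  ext x
  rw [Geometry.SimplicialComplex.mem_space_iff]
  constructor
  · rintro ⟨_, ⟨C, -, -, rfl⟩, hx⟩
    rw [coe_image] at hx
    exact convexHull_mono (Set.image_subset_range v C) hx
  · intro hx
    obtain ⟨s, hs, -, hxs⟩ := h.exists_simplex_of_mem_face (isFace_refl ⟨x, hx⟩) hx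
    exact ⟨s, hs, hxs⟩

theorem apex_mem_of_maximal [DecidableEq X] (hF : IsFace (convexHull ℝ (Set.range v)) F) {a : X}
    (ha : v a ∈ F) (hinsert : ∀ C ∈ 𝒞, (∀ b ∈ C, v b ∈ F) → insert a C ∈ 𝒞) {s : Finset E}
    (hs : s ∈ h.complex.faces) (hsF : convexHull ℝ (s : Set E) ⊆ F)
    (hmax : ∀ t ∈ h.complex.faces, convexHull ℝ (t : Set E) ⊆ F → s ⊆ t → t = s) :
    v a ∈ s := by
  obtain ⟨C, hC, -, rfl⟩ := hs
  have hCF : ∀ b ∈ C, v b ∈ F := fun b hb =>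
    hsF (subset_convexHull ℝ _ (mem_coe.2 (mem_image_of_mem v hb)))
  have hinsF : convexHull ℝ ((insert a C).image v : Set E) ⊆ F := by
    rw [coe_image]
    refine convexHull_min ?_ (hF.1.convex (convex_convexHull ℝ _))
    rintro _ ⟨b, hb, rfl⟩
    rcases mem_insert.1 (mem_coe.1 hb) with rfl | hb
    exacts [ha, hCF b hb]
  rw [← hmax _ ⟨_, hinsert C hC hCF, insert_nonempty a C, rfl⟩ hinsF
    (image_subset_image (subset_insert a C))]
  exact mem_image_of_mem v (mem_insert_self a C)

theorem exists_isPointedTriangulation [DecidableEq X] {c : E →ₗ[ℝ] ℝ}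
    (hc : Function.Injective (c ∘ v))
    (hinsert : ∀ F, IsFace (convexHull ℝ (Set.range v)) F → ∀ a, IsMinVertex v c F a →
      ∀ C ∈ 𝒞, (∀ b ∈ C, v b ∈ F) → insert a C ∈ 𝒞) :
    ∃ V, IsPointedTriangulation (convexHull ℝ (Set.range v)) V h.complex := by
  have hex : ∀ F, IsFace (convexHull ℝ (Set.range v)) F →
      ∃ e, ∃ a, v a = e ∧ IsMinVertex v c F a := fun F hF => by
    obtain ⟨a, ha⟩ := hF.exists_isMinVertex hc
    exact ⟨v a, a, rfl, ha⟩
  choose! V hV using hex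
  have hmin : ∀ F, IsFace (convexHull ℝ (Set.range v)) F → ∀ x ∈ F, c (V F) ≤ c x :=
    fun F hF x hx => by
      obtain ⟨a, haV, ha⟩ := hV F hF
      exact haV ▸ ha.apply_le_apply hF hx
  have hvertex : (convexHull ℝ (Set.range v)).extremePoints ℝ ⊆ Set.range v :=
    extremePoints_convexHull_subset
  refine ⟨V, h.finite_faces_complex, h.space_complex, fun F hF => ?_,
    fun F hF x hx => h.exists_simplex_of_mem_face hF hx, fun F hF s hs hsF hmax => ?_,
    fun F G hF hG hFmem hGmem => ?_, fun F hF w hw hne => ?_, c, fun x hx y hy hxy => ?_, hmin⟩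
  · obtain ⟨a, haV, ha⟩ := hV F hF
    exact haV ▸ ha.mem_extremePoints hF
  · obtain ⟨a, haV, ha⟩ := hV F hF
    exact haV ▸ h.apex_mem_of_maximal hF ha.1 (hinsert F hF a ha) hs hsF hmax
  · obtain ⟨a, haV, -⟩ := hV F hF
    obtain ⟨b, hbV, -⟩ := hV G hG
    have hle := (hmin F hF _ hGmem.1).antisymm (hmin G hG _ hFmem.2)
    rw [← haV, ← hbV] at hle ⊢
    rw [hc hle]
  · obtain ⟨b, rfl⟩ := hvertex (hF.extremePoints_subset hw)
    obtain ⟨a, haV, ha⟩ := hV F hF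
    refine ⟨_, ⟨_, hinsert F hF a ha {b} (h.singleton_mem b) (by simpa using hw.1),
      insert_nonempty _ _, rfl⟩, ?_⟩
    simp [← haV]
  · obtain ⟨a, rfl⟩ := hvertex hx
    obtain ⟨b, rfl⟩ := hvertex hy
    rw [hc hxy]

end IsTriangulationFamily

end Triangulations

section Chains

variable {ι : Type*} {κ : ι → Type*} [∀ j, LinearOrder (κ j)]

theorem exists_forall_le_of_apply_le [Nonempty ι] {C : Finset (∀ j, κ j)}
    (hC : IsChain (· ≤ ·) (C : Set (∀ j, κ j))) (p : ∀ j, κ j) :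
    ∃ j, ∀ q ∈ C, q j ≤ p j → q ≤ p := by
  classical
  rcases ({q ∈ C | ¬ q ≤ p}).eq_empty_or_nonempty with hempty | hne
  · simp only [filter_eq_empty_iff, not_not] at hempty
    exact ⟨Classical.arbitrary ι, fun q hq _ => hempty hq⟩
  obtain ⟨r, hr⟩ := exists_minimal hne
  obtain ⟨hrC, hrp⟩ := mem_filter.1 hr.prop
  obtain ⟨j, hj⟩ := not_forall.1 hrp
  refine ⟨j, fun q hq hqj => ?_⟩
  by_contra hqp
  have hrq : r ≤ q := (hC.total hrC hq).elim id fun hqr => hr.2 (mem_filter.2 ⟨hq, hqp⟩) hqr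
  exact hj ((hrq j).trans hqj)

theorem exists_minimal_support [Finite ι] [Nonempty ι] [∀ j, Fintype (κ j)]
    {c : ∀ j, κ j → ℝ} (hc : ∀ j, 0 ≤ c j) (hpos : ∀ j, 0 < ∑ k, c j k) :
    ∃ (p : ∀ j, κ j) (i : ι), (∀ j k, c j k ≠ 0 → p j ≤ k) ∧ 0 < c i (p i) ∧
      ∀ j, c i (p i) ≤ c j (p j) := by
  have hmin : ∀ j, ∃ k, c j k ≠ 0 ∧ ∀ k', c j k' ≠ 0 → k ≤ k' := fun j => by
    obtain ⟨k, -, hk⟩ := exists_ne_zero_of_sum_ne_zero (hpos j).ne'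
    obtain ⟨k, hk, hkmin⟩ := exists_min_image {k | c j k ≠ 0} id ⟨k, by simpa using hk⟩
    exact ⟨k, by simpa using hk, by simpa using hkmin⟩
  choose p hp hpmin using hmin
  obtain ⟨i, hi⟩ := Finite.exists_min fun j => c j (p j)
  exact ⟨p, i, hpmin, (hc i _).lt_of_ne' (hp i), hi⟩

variable [Fintype ι] [DecidableEq ι] [∀ j, Fintype (κ j)]

/-- The `j`-th marginal of weights on a finite product. -/
def marginal (μ : (∀ j, κ j) → ℝ) (j : ι) (k : κ j) : ℝ :=
  ∑ q with q j = k, μ q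

theorem marginal_add (μ ν : (∀ j, κ j) → ℝ) : marginal (μ + ν) = marginal μ + marginal ν := by
  funext j k
  exact sum_add_distrib

theorem marginal_single (p : ∀ j, κ j) (t : ℝ) (j : ι) :
    marginal (Pi.single p t) j = Pi.single (p j) t := by
  funext k
  simp [marginal, Pi.single_apply, eq_comm (a := k)]

theorem marginal_pos {μ : (∀ j, κ j) → ℝ} (hμ : 0 ≤ μ) {q : ∀ j, κ j} (hq : μ q ≠ 0) (j : ι) :
    0 < marginal μ j (q j) :=
  sum_pos' (fun q _ => hμ q) ⟨q, by simp, (hμ q).lt_of_ne' hq⟩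

theorem sum_marginal (μ : (∀ j, κ j) → ℝ) (j : ι) : ∑ k, marginal μ j k = ∑ q, μ q :=
  sum_fiberwise univ (fun q : ∀ j, κ j => q j) μ

theorem sum_filter_apply_le_eq_sum_marginal (μ : (∀ j, κ j) → ℝ) (j : ι) (k : κ j) :
    ∑ q with q j ≤ k, μ q = ∑ i with i ≤ k, marginal μ j i := by
  rw [← sum_fiberwise_of_maps_to (t := {i | i ≤ k}) (g := fun q => q j) (by simp)]
  refine sum_congr rfl fun i hi => sum_congr ?_ fun _ _ => rfl
  rw [filter_filter]
  refine filter_congr fun q _ => and_iff_right_of_imp ?_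
  rintro rfl
  exact (mem_filter.1 hi).2

open Classical in
theorem sum_filter_le_le_of_marginal_eq [Nonempty ι] {C : Finset (∀ j, κ j)}
    {μ ν : (∀ j, κ j) → ℝ} (hC : IsChain (· ≤ ·) (C : Set (∀ j, κ j))) (hμ : IsWeightOn C μ)
    (hν : 0 ≤ ν) (h : marginal μ = marginal ν) (p : ∀ j, κ j) :
    ∑ q with q ≤ p, ν q ≤ ∑ q with q ≤ p, μ q := by
  obtain ⟨j, hj⟩ := exists_forall_le_of_apply_le hC p
  have hsub : ({q | q ≤ p} : Finset (∀ j, κ j)) ⊆ ({q | q j ≤ p j} : Finset (∀ j, κ j)) :=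
    monotone_filter_right _ fun q _ hq => hq j
  calc ∑ q with q ≤ p, ν q ≤ ∑ q with q j ≤ p j, ν q :=
        sum_le_sum_of_subset_of_nonneg hsub fun q _ _ => hν q
    _ = ∑ q with q j ≤ p j, μ q := by
        rw [sum_filter_apply_le_eq_sum_marginal, sum_filter_apply_le_eq_sum_marginal, h]
    _ = ∑ q with q ≤ p, μ q := by
        refine (sum_subset hsub fun q hq hqp => hμ.eq_zero q fun hqC => hqp ?_).symm
        simpa using hj q hqC (mem_filter.1 hq).2

theorem eq_of_marginal_eq [Nonempty ι] {C D : Finset (∀ j, κ j)} {μ ν : (∀ j, κ j) → ℝ}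
    (hC : IsChain (· ≤ ·) (C : Set (∀ j, κ j))) (hD : IsChain (· ≤ ·) (D : Set (∀ j, κ j)))
    (hμ : IsWeightOn C μ) (hν : IsWeightOn D ν) (h : marginal μ = marginal ν) : μ = ν := by
  classical
  have hsum : ∀ p, ∑ q with q ≤ p, μ q = ∑ q with q ≤ p, ν q := fun p =>
    le_antisymm (sum_filter_le_le_of_marginal_eq hD hν hμ.nonneg h.symm p)
      (sum_filter_le_le_of_marginal_eq hC hμ hν.nonneg h p)
  funext p
  induction p using WellFoundedLT.induction with
  | ind p ih =>
    have hp : ({q | q ≤ p} : Finset (∀ j, κ j)) = insert p ({q | q < p} : Finset _) := by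
      ext q
      simp only [mem_filter, mem_univ, true_and, mem_insert, le_iff_eq_or_lt]
    have hsp := hsum p
    rw [hp, sum_insert (by simp), sum_insert (by simp),
      sum_congr rfl fun q hq => ih q (mem_filter.1 hq).2] at hsp
    exact add_right_cancel hsp

theorem exists_isWeightOn_chain_add_single {C : Finset (∀ j, κ j)} {μ : (∀ j, κ j) → ℝ}
    (hC : IsChain (· ≤ ·) (C : Set (∀ j, κ j))) (hμ : IsWeightOn C μ) {p : ∀ j, κ j}
    (hp : ∀ q, μ q ≠ 0 → p ≤ q) {t : ℝ} (ht : 0 ≤ t) :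
    ∃ (D : Finset (∀ j, κ j)) (ν : (∀ j, κ j) → ℝ), IsChain (· ≤ ·) (D : Set (∀ j, κ j)) ∧
      IsWeightOn D ν ∧ marginal ν = marginal μ + fun j => Pi.single (p j) t := by
  refine ⟨insert p {q ∈ C | μ q ≠ 0}, μ + Pi.single p t, ?_, ⟨?_, fun q hq => ?_⟩, ?_⟩
  · rw [coe_insert]
    exact (hC.mono (coe_subset.2 (filter_subset _ C))).insert fun q hq _ =>
      .inl (hp q (mem_filter.1 hq).2)
  · exact add_nonneg hμ.nonneg (Pi.single_nonneg.2 ht)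
  · rw [mem_insert, mem_filter, not_or] at hq
    have hμq : μ q = 0 := by_contra fun h => hq.2 ⟨hμ.mem h, h⟩
    simp [hμq, hq.1]
  · rw [marginal_add, funext (marginal_single p t)]

/-- The northwest corner rule: move as much mass as possible to the least point `p` of the product
of the supports of the marginals, and continue with the remaining marginals. -/
theorem exists_isWeightOn_chain [Nonempty ι] (c : ∀ j, κ j → ℝ) (hc : ∀ j, 0 ≤ c j) (m : ℝ)
    (hm : ∀ j, ∑ k, c j k = m) : ∃ (C : Finset (∀ j, κ j)) (μ : (∀ j, κ j) → ℝ),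
      IsChain (· ≤ ·) (C : Set (∀ j, κ j)) ∧ IsWeightOn C μ ∧ marginal μ = c := by
  induction hn : ∑ j, #{k | c j k ≠ 0} using Nat.strong_induction_on generalizing c m with
  | h n ih =>
  have hm0 : 0 ≤ m := (hm (Classical.arbitrary ι)) ▸ sum_nonneg fun k _ => hc _ k
  rcases hm0.eq_or_lt with rfl | hm0
  · refine ⟨∅, 0, by simp, ⟨le_rfl, fun _ _ => rfl⟩, funext fun j => funext fun k => ?_⟩
    rw [(sum_eq_zero_iff_of_nonneg fun k _ => hc j k).1 (hm j) k (mem_univ k)]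
    simp [marginal]
  obtain ⟨p, i, hpmin, hpos, hi⟩ := exists_minimal_support hc fun j => (hm j).symm ▸ hm0
  set t := c i (p i) with ht
  let c' : ∀ j, κ j → ℝ := fun j => c j - Pi.single (p j) t
  have hc'_self : ∀ j, c' j (p j) = c j (p j) - t := fun j => by simp [c']
  have hc'_ne : ∀ j k, k ≠ p j → c' j k = c j k := fun j k hk => by simp [c', hk]
  have hc' : ∀ j, 0 ≤ c' j := fun j k => by
    rcases eq_or_ne k (p j) with rfl | hk
    · exact (hc'_self j).symm ▸ sub_nonneg.2 (hi j)
    · exact (hc'_ne j k hk).symm ▸ hc j k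
  have hsupp : ∀ j k, c' j k ≠ 0 → c j k ≠ 0 := fun j k hne => by
    rcases eq_or_ne k (p j) with rfl | hk
    · exact (hpos.trans_le (hi j)).ne'
    · rwa [← hc'_ne j k hk]
  have hcard : ∑ j, #{k | c' j k ≠ 0} < n := by
    rw [← hn]
    refine sum_lt_sum (fun j _ => card_le_card (monotone_filter_right _ fun k _ => hsupp j k))
      ⟨i, mem_univ i, card_lt_card ?_⟩
    refine (ssubset_iff_of_subset (monotone_filter_right _ fun k _ => hsupp i k)).2
      ⟨p i, by simpa using hpos.ne', by simp [hc'_self, ht]⟩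
  obtain ⟨C, μ, hC, hμ, hmarg⟩ := ih _ hcard c' hc' (m - t) (fun j => by simp [c', hm]) rfl
  have hle : ∀ q, μ q ≠ 0 → p ≤ q := fun q hq j => hpmin j _ <| hsupp j _ <| by
    rw [← hmarg]
    exact (marginal_pos hμ.nonneg hq j).ne'
  obtain ⟨D, ν, hD, hν, hνμ⟩ := exists_isWeightOn_chain_add_single hC hμ hle hpos.le
  refine ⟨D, ν, hD, hν, ?_⟩
  rw [hνμ, hmarg]
  exact funext fun j => sub_add_cancel (c j) (Pi.single (p j) t)

end Chains

section Words

variable {l N : ℕ}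

/-- The content of a word: the number of occurrences of each letter. -/
def content (w : Fin N → Fin l) (j : Fin l) : ℕ :=
  #{k | w k = j}

/-- The content of the word formed by the first `i` letters of `w`. -/
def prefixCount (w : Fin N → Fin l) (i : ℕ) (j : Fin l) : ℕ :=
  #{k : Fin N | (k : ℕ) < i ∧ w k = j}

theorem prefixCount_length (w : Fin N → Fin l) : prefixCount w N = content w := by
  funext j
  simp [prefixCount, content]

theorem prefixCount_mono (w : Fin N → Fin l) : Monotone (prefixCount w) := fun _ _ hi _ =>
  card_le_card (monotone_filter_right _ fun _ _ hk => ⟨hk.1.trans_le hi, hk.2⟩)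

theorem prefixCount_le_content (w : Fin N → Fin l) (i : ℕ) : prefixCount w i ≤ content w :=
  fun _ => card_le_card (monotone_filter_right _ fun _ _ hk => hk.2)

theorem sum_prefixCount (w : Fin N → Fin l) {i : ℕ} (hi : i ≤ N) :
    ∑ j, prefixCount w i j = i := by
  simp only [prefixCount, ← filter_filter]
  rw [← card_eq_sum_card_fiberwise fun _ _ => mem_coe.2 (mem_univ _), Fin.card_filter_val_lt,
    min_eq_right hi]

theorem sum_content (w : Fin N → Fin l) : ∑ j, content w j = N := by
  rw [← prefixCount_length, sum_prefixCount w le_rfl]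

theorem prefixCount_snoc (w : Fin N → Fin l) (j : Fin l) {i : ℕ} (hi : i ≤ N) :
    prefixCount (Fin.snoc (α := fun _ => Fin l) w j) i = prefixCount w i := by
  funext j'
  simp only [prefixCount, card_filter, Fin.sum_univ_castSucc, Fin.snoc_castSucc,
    Fin.val_castSucc, Fin.val_last, hi.not_gt, false_and, if_false, add_zero]

theorem content_snoc (w : Fin N → Fin l) (j : Fin l) :
    content (Fin.snoc (α := fun _ => Fin l) w j) = content w + Pi.single j 1 := by
  funext j'
  simp only [content, card_filter, Fin.sum_univ_castSucc, Fin.snoc_castSucc, Fin.snoc_last,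
    Pi.add_apply, Pi.single_apply, eq_comm (a := j)]

theorem exists_forall_le_sub_single {d : Fin l → ℕ} (hd : d ≠ 0) {C : Finset (Fin l → ℕ)}
    (hC : IsChain (· ≤ ·) (C : Set (Fin l → ℕ))) (hCd : ∀ q ∈ C, q ≤ d) :
    ∃ j, 0 < d j ∧ ∀ q ∈ C.erase d, q ≤ d - Pi.single j 1 := by
  have hC0 : IsChain (· ≤ ·) (((insert 0 C).erase d : Finset _) : Set (Fin l → ℕ)) := by
    refine IsChain.mono (coe_subset.2 (erase_subset d _)) ?_
    rw [coe_insert]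
    exact hC.insert fun q _ _ => .inl fun _ => Nat.zero_le _
  obtain ⟨r, hr, hrmax⟩ : ∃ r ∈ (insert 0 C).erase d, ∀ q ∈ (insert 0 C).erase d, q ≤ r := by
    obtain ⟨r, hr⟩ := exists_maximal ⟨0, mem_erase.2 ⟨hd.symm, mem_insert_self 0 C⟩⟩
    exact ⟨r, hr.prop, fun q hq => (hC0.total hq hr.prop).elim id fun hrq => hr.2 hq hrq⟩
  obtain ⟨hrd, hrC⟩ := mem_erase.1 hr
  have hrle : r ≤ d := (mem_insert.1 hrC).elim (fun h => h ▸ fun _ => Nat.zero_le _) (hCd r)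
  obtain ⟨-, j, hj⟩ := Pi.lt_def.1 (hrle.lt_of_ne hrd)
  refine ⟨j, (Nat.zero_le _).trans_lt hj, fun q hq j' => ?_⟩
  have hqr : q ≤ r := hrmax q (erase_subset_erase d (subset_insert 0 C) hq)
  rcases eq_or_ne j' j with rfl | hne
  · simpa using Nat.le_sub_one_of_lt ((hqr j').trans_lt hj)
  · simpa [hne] using (hqr j').trans (hrle j')

theorem exists_word_of_isChain {d : Fin l → ℕ} (hd : ∑ j, d j = N) {C : Finset (Fin l → ℕ)}
    (hC : IsChain (· ≤ ·) (C : Set (Fin l → ℕ))) (hCd : ∀ q ∈ C, q ≤ d) :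
    ∃ w : Fin N → Fin l, content w = d ∧ ∀ q ∈ C, ∃ i ≤ N, prefixCount w i = q := by
  induction N generalizing d C with
  | zero =>
    obtain rfl : d = 0 := funext fun j => sum_eq_zero_iff.1 hd j (mem_univ j)
    exact ⟨Fin.elim0, by funext j; simp [content], fun q hq => ⟨0, le_rfl, by
      funext j; simp [prefixCount, Nat.eq_zero_of_le_zero (hCd q hq j)]⟩⟩
  | succ N ih =>
    have hd0 : d ≠ 0 := by rintro rfl; simp at hd
    obtain ⟨j, hj, hle⟩ := exists_forall_le_sub_single hd0 hC hCd
    have hadd : d - Pi.single j 1 + Pi.single j 1 = d :=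
      tsub_add_cancel_of_le (update_le_iff.2 ⟨hj, fun _ _ => Nat.zero_le _⟩)
    obtain ⟨w, hw, hwC⟩ := ih (d := d - Pi.single j 1) (by
      rw [← hadd] at hd
      simpa [sum_add_distrib] using hd) (hC.mono (coe_subset.2 (erase_subset d C))) hle
    have hsnoc : content (Fin.snoc (α := fun _ => Fin l) w j) = d := by
      rw [content_snoc, hw, hadd]
    refine ⟨_, hsnoc, fun q hq => ?_⟩
    rcases eq_or_ne q d with rfl | hne
    · exact ⟨N + 1, le_rfl, (prefixCount_length _).trans hsnoc⟩
    · obtain ⟨i, hi, rfl⟩ := hwC q (mem_erase.2 ⟨hne, hq⟩)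
      exact ⟨i, hi.trans N.le_succ, prefixCount_snoc w j hi⟩

/-- The finite chains of a partial order, the simplices of its order complex. -/
def chainFamily (α : Type*) [LE α] : Set (Finset α) :=
  {C | IsChain (· ≤ ·) (C : Set α)}

variable {d : Fin l → ℕ}

/-- The lattice path whose `k`-th step increases the coordinate `w k`. -/
def pathPoint {w : Fin N → Fin l} (hw : content w = d) (i : ℕ) (j : Fin l) : Fin (d j + 1) :=
  ⟨prefixCount w i j, Nat.lt_succ_of_le (hw ▸ prefixCount_le_content w i j)⟩

/-- The set of lattice points on the path of `w`. -/
def pathChain {w : Fin N → Fin l} (hw : content w = d) : Finset (∀ j, Fin (d j + 1)) :=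
  univ.image fun i : Fin (N + 1) => pathPoint hw i

theorem pathChain_mem_chainFamily {w : Fin N → Fin l} (hw : content w = d) :
    pathChain hw ∈ chainFamily (∀ j, Fin (d j + 1)) := by
  have hmono : Monotone fun i : Fin (N + 1) => pathPoint hw i :=
    fun i i' h j => prefixCount_mono w h j
  simpa only [chainFamily, Set.mem_ofPred_eq, pathChain, coe_image, coe_univ, Set.image_univ]
    using hmono.isChain_range

theorem maximal_pathChain {w : Fin N → Fin l} (hw : content w = d) :
    Maximal (· ∈ chainFamily (∀ j, Fin (d j + 1))) (pathChain hw) := by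
  refine ⟨pathChain_mem_chainFamily hw, fun D hD hle q hq => ?_⟩
  have hqN : ∑ j, (q j : ℕ) ≤ N := by
    rw [← sum_content w, hw]
    exact sum_le_sum fun j _ => Nat.le_of_lt_succ (q j).2
  set p := pathPoint hw (∑ j, (q j : ℕ))
  have hp : p ∈ pathChain hw := mem_image.2 ⟨⟨_, Nat.lt_succ_of_le hqN⟩, mem_univ _, rfl⟩
  have hsum : ∑ j, (p j : ℕ) = ∑ j, (q j : ℕ) := sum_prefixCount w hqN
  have heq : ∀ a b : ∀ j, Fin (d j + 1), a ≤ b → ∑ j, (a j : ℕ) = ∑ j, (b j : ℕ) → a = b := by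
    intro a b hab h
    rw [sum_eq_sum_iff_of_le fun j _ => hab j] at h
    exact funext fun j => Fin.ext (h j (mem_univ j))
  rcases hD.total (hle hp) hq with hpq | hqp
  · rwa [← heq _ _ hpq hsum]
  · rwa [heq _ _ hqp hsum.symm]

theorem exists_subset_pathChain (hd : ∑ j, d j = N) {C : Finset (∀ j, Fin (d j + 1))}
    (hC : C ∈ chainFamily _) :
    ∃ (w : Fin N → Fin l) (hw : content w = d), C ⊆ pathChain hw := by
  let val : (∀ j, Fin (d j + 1)) → Fin l → ℕ := fun q j => q j
  obtain ⟨w, hw, hwC⟩ := exists_word_of_isChain hd (C := C.image val)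
    (by rw [coe_image]; exact Monotone.isChain_image (fun _ _ h => h) hC)
    (by
      intro q hq
      obtain ⟨p, -, rfl⟩ := mem_image.1 hq
      exact fun j => Nat.le_of_lt_succ (p j).2)
  refine ⟨w, hw, fun q hq => ?_⟩
  obtain ⟨i, hi, hiq⟩ := hwC _ (mem_image_of_mem val hq)
  exact mem_image.2 ⟨⟨i, Nat.lt_succ_of_le hi⟩, mem_univ _,
    funext fun j => Fin.ext (congrFun hiq j)⟩

theorem maximal_chainFamily_iff (hd : ∑ j, d j = N) {C : Finset (∀ j, Fin (d j + 1))} :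
    Maximal (· ∈ chainFamily (∀ j, Fin (d j + 1))) C ↔
      ∃ (w : Fin N → Fin l) (hw : content w = d), pathChain hw = C := by
  constructor
  · intro hC
    obtain ⟨w, hw, hsub⟩ := exists_subset_pathChain hd hC.prop
    exact ⟨w, hw, (hC.eq_of_le (pathChain_mem_chainFamily hw) hsub).symm⟩
  · rintro ⟨w, hw, rfl⟩
    exact maximal_pathChain hw

end Words

/-- A linear parametrization of a polytope in `E` by a product of standard simplices, with
barycentric coordinates given by affine functions `x ↦ coord j k x + off j k` on `E`. -/
structure SimplexProductParam {ι : Type*} (κ : ι → Type*) [∀ j, Fintype (κ j)] (E : Type*)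
    [AddCommGroup E] [Module ℝ E] [TopologicalSpace E] where
  toLin : (∀ j, κ j → ℝ) →ₗ[ℝ] E
  coord : ∀ j, κ j → StrongDual ℝ E
  off : ∀ j, κ j → ℝ
  coord_toLin : ∀ c, (∀ j, c j ∈ stdSimplex ℝ (κ j)) → ∀ j k,
    coord j k (toLin c) + off j k = c j k

/-- The tuples of points of standard simplices whose `j`-th component is supported in `S j`. -/
def stdSimplexOn {ι : Type*} {κ : ι → Type*} [∀ j, Fintype (κ j)] (S : ∀ j, Finset (κ j)) :
    Set (∀ j, κ j → ℝ) :=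
  {c | ∀ j, c j ∈ stdSimplex ℝ (κ j) ∧ ∀ k ∉ S j, c j k = 0}

section StdSimplexOn

variable {ι : Type*} {κ : ι → Type*} [∀ j, Fintype (κ j)] {S T : ∀ j, Finset (κ j)}
  {c e : ∀ j, κ j → ℝ}

theorem stdSimplexOn_mono (h : S ≤ T) : stdSimplexOn S ⊆ stdSimplexOn T := fun _ hc j =>
  ⟨(hc j).1, fun k hk => (hc j).2 k fun hkS => hk (h j hkS)⟩

theorem stdSimplexOn_singleton [∀ j, DecidableEq (κ j)] (q : ∀ j, κ j) :
    stdSimplexOn (fun j => {q j}) = {fun j => Pi.single (q j) 1} := by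
  refine Set.eq_singleton_iff_unique_mem.2 ⟨fun j => ⟨single_mem_stdSimplex ℝ (q j), fun k hk =>
    Pi.single_eq_of_ne (by simpa using hk) _⟩, fun c hc => funext fun j => funext fun k => ?_⟩
  have hne : ∀ k, k ≠ q j → c j k = 0 := fun k hk => (hc j).2 k (by simpa using hk)
  rcases eq_or_ne k (q j) with rfl | hk
  · rw [Pi.single_eq_same, ← (hc j).1.2, sum_eq_single (q j) (fun k _ => hne k) (by simp)]
  · rw [Pi.single_eq_of_ne hk, hne k hk]

theorem mul_nonneg_of_mem_stdSimplexOn (hc : c ∈ stdSimplexOn S) (he : ∀ j, ∀ k ∈ S j, 0 ≤ e j k)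
    (j : ι) (k : κ j) : 0 ≤ c j k * e j k := by
  by_cases hk : k ∈ S j
  · exact mul_nonneg ((hc j).1.1 k) (he j k hk)
  · rw [(hc j).2 k hk, zero_mul]

variable [Fintype ι]

theorem sum_mul_nonneg_of_mem_stdSimplexOn (hc : c ∈ stdSimplexOn S)
    (he : ∀ j, ∀ k ∈ S j, 0 ≤ e j k) : 0 ≤ ∑ j, ∑ k, c j k * e j k :=
  sum_nonneg fun j _ => sum_nonneg fun k _ => mul_nonneg_of_mem_stdSimplexOn hc he j k

theorem sum_mul_eq_zero_iff_of_mem_stdSimplexOn (hc : c ∈ stdSimplexOn S)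
    (hzero : ∀ j, ∀ k ∈ T j, e j k = 0) (hpos : ∀ j, ∀ k ∈ S j, k ∉ T j → 0 < e j k) :
    ∑ j, ∑ k, c j k * e j k = 0 ↔ c ∈ stdSimplexOn T := by
  have he : ∀ j, ∀ k ∈ S j, 0 ≤ e j k := fun j k hk => by
    by_cases hkT : k ∈ T j
    exacts [(hzero j k hkT).ge, (hpos j k hk hkT).le]
  have hnn := mul_nonneg_of_mem_stdSimplexOn hc he
  constructor
  · refine fun h j => ⟨(hc j).1, fun k hkT => ?_⟩
    by_cases hkS : k ∈ S j
    · rw [sum_eq_zero_iff_of_nonneg fun j _ => sum_nonneg fun k _ => hnn j k] at h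
      have hjk := (sum_eq_zero_iff_of_nonneg fun k _ => hnn j k).1 (h j (mem_univ j)) k (mem_univ k)
      exact (mul_eq_zero.1 hjk).resolve_right (hpos j k hkS hkT).ne'
    · exact (hc j).2 k hkS
  · refine fun h => sum_eq_zero fun j _ => sum_eq_zero fun k _ => ?_
    by_cases hkT : k ∈ T j
    · rw [hzero j k hkT, mul_zero]
    · rw [(h j).2 k hkT, zero_mul]

end StdSimplexOn

theorem injective_image_pair {l : ℕ} {d : Fin l → ℕ} :
    Function.Injective fun q : ∀ j, Fin (d j + 1) => univ.image fun j => Nat.pair (q j) j := by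
  intro q q' h
  funext j
  have hj : Nat.pair (q j) j ∈ univ.image fun j => Nat.pair (q' j) j :=
    (Finset.ext_iff.1 h _).1 (mem_image_of_mem _ (mem_univ j))
  obtain ⟨j', -, he⟩ := mem_image.1 hj
  obtain ⟨hq, hj'⟩ := Nat.pair_eq_pair.1 he
  obtain rfl : j' = j := Fin.ext hj'
  exact Fin.ext hq.symm

namespace SimplexProductParam

section Faces

variable {ι : Type*} {κ : ι → Type*} [∀ j, Fintype (κ j)] {E : Type*} [AddCommGroup E]
  [Module ℝ E] [TopologicalSpace E] (M : SimplexProductParam κ E) {S T : ∀ j, Finset (κ j)}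

/-- The face of the parametrized polytope with vertices in `S`. -/
def face (S : ∀ j, Finset (κ j)) : Set E :=
  M.toLin '' stdSimplexOn S

/-- The parametrized polytope. -/
def polytope : Set E :=
  M.toLin '' Set.univ.pi fun j => stdSimplex ℝ (κ j)

theorem face_univ : M.face (fun _ => univ) = M.polytope := by
  simp [face, polytope, stdSimplexOn, Set.pi]

theorem face_mono (h : S ≤ T) : M.face S ⊆ M.face T :=
  Set.image_mono (stdSimplexOn_mono h)

/-- The vertex with index `q j` in the factor `j`. -/
def vertex [∀ j, DecidableEq (κ j)] (q : ∀ j, κ j) : E :=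
  M.toLin fun j => Pi.single (q j) 1

section Vertices

variable [∀ j, DecidableEq (κ j)]

theorem face_singleton (q : ∀ j, κ j) : M.face (fun j => {q j}) = {M.vertex q} := by
  rw [face, stdSimplexOn_singleton, Set.image_singleton, vertex]

theorem coord_vertex (q : ∀ j, κ j) (j : ι) (k : κ j) :
    M.coord j k (M.vertex q) = (if q j = k then 1 else 0) - M.off j k := by
  rw [eq_sub_iff_add_eq, vertex, M.coord_toLin _ fun j => single_mem_stdSimplex ℝ (q j),
    Pi.single_apply]
  simp only [eq_comm]

theorem vertex_mem_face_iff {q : ∀ j, κ j} : M.vertex q ∈ M.face S ↔ ∀ j, q j ∈ S j := by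
  constructor
  · rintro ⟨c, hc, hcq⟩ j
    by_contra hj
    have hzero := M.coord_toLin c (fun j => (hc j).1) j (q j)
    rw [hcq, M.coord_vertex, (hc j).2 _ hj, if_pos rfl, sub_add_cancel] at hzero
    exact one_ne_zero hzero
  · intro h
    exact M.face_mono (fun j => singleton_subset_iff.2 (h j))
      (M.face_singleton q ▸ Set.mem_singleton _)

theorem polytope_eq_convexHull [Finite ι] :
    M.polytope = convexHull ℝ (Set.range M.vertex) := by
  have hrange : Set.range M.vertex =
      M.toLin '' Set.univ.pi fun j => Set.range fun k : κ j => Pi.single k (1 : ℝ) := by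
    rw [← Set.range_piMap, ← Set.range_comp]
    rfl
  rw [hrange, ← M.toLin.image_convexHull, convexHull_pi]
  simp only [convexHull_rangle_single_eq_stdSimplex, polytope]

end Vertices

theorem face_subset_face_iff (hS : ∀ j, (S j).Nonempty) : M.face S ⊆ M.face T ↔ S ≤ T := by
  classical
  refine ⟨fun h j k hk => ?_, M.face_mono⟩
  choose s hs using hS
  have hvertex := M.vertex_mem_face_iff.1 (h ((M.vertex_mem_face_iff (q := Function.update s j k)).2
    (Function.forall_update_iff s (p := fun i x => x ∈ S i) |>.2 ⟨hk, fun i _ => hs i⟩))) j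
  rwa [Function.update_self] at hvertex

theorem injOn_face : Set.InjOn M.face {S | ∀ j, (S j).Nonempty} := fun _ hS _ hT h =>
  ((M.face_subset_face_iff hS).1 h.le).antisymm ((M.face_subset_face_iff hT).1 h.ge)

theorem face_subsingleton_iff (hS : ∀ j, (S j).Nonempty) :
    (M.face S).Subsingleton ↔ ∀ j, #(S j) = 1 := by
  classical
  constructor
  · intro h j
    choose s hs using hS
    have hle : M.face S ⊆ M.face fun j => {s j} := fun x hx => by
      rw [M.face_singleton, Set.mem_singleton_iff]
      exact h hx (M.vertex_mem_face_iff.2 hs)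
    rw [M.face_subset_face_iff fun j => ⟨s j, hs j⟩] at hle
    exact card_eq_one.2 ⟨s j, (hle j).antisymm (singleton_subset_iff.2 (hs j))⟩
  · intro h
    choose s hs using fun j => card_eq_one.1 (h j)
    rw [funext hs, M.face_singleton]
    exact Set.subsingleton_singleton

theorem setOf_forall_le_eq_face [Fintype ι] (hTS : T ≤ S) (hT : ∀ j, (T j).Nonempty)
    {l : E → ℝ} {B : ℝ} {e : ∀ j, κ j → ℝ}
    (hl : ∀ c ∈ stdSimplexOn S, l (M.toLin c) = B - ∑ j, ∑ k, c j k * e j k)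
    (hzero : ∀ j, ∀ k ∈ T j, e j k = 0) (hpos : ∀ j, ∀ k ∈ S j, k ∉ T j → 0 < e j k) :
    {x ∈ M.face S | ∀ y ∈ M.face S, l y ≤ l x} = M.face T := by
  classical
  have he : ∀ j, ∀ k ∈ S j, 0 ≤ e j k := fun j k hk => by
    by_cases hkT : k ∈ T j
    exacts [(hzero j k hkT).ge, (hpos j k hk hkT).le]
  have hiff : ∀ c ∈ stdSimplexOn S, l (M.toLin c) = B ↔ c ∈ stdSimplexOn T := fun c hc => by
    rw [hl c hc, sub_eq_self, sum_mul_eq_zero_iff_of_mem_stdSimplexOn hc hzero hpos]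
  have hmem : ∀ c ∈ stdSimplexOn T, l (M.toLin c) = B := fun c hc =>
    (hiff c (stdSimplexOn_mono hTS hc)).2 hc
  choose t ht using hT
  obtain ⟨c, hc, -⟩ := M.vertex_mem_face_iff.2 ht
  have hgreatest : IsGreatest (l '' M.face S) B := by
    refine ⟨⟨_, M.face_mono hTS ⟨c, hc, rfl⟩, hmem c hc⟩, ?_⟩
    rintro _ ⟨_, ⟨c, hc, rfl⟩, rfl⟩
    rw [hl c hc]
    exact sub_le_self B (sum_mul_nonneg_of_mem_stdSimplexOn hc he)
  rw [setOf_forall_le_eq_of_isGreatest hgreatest]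
  ext x
  constructor
  · rintro ⟨⟨c, hc, rfl⟩, hx⟩
    exact ⟨c, (hiff c hc).1 hx, rfl⟩
  · rintro ⟨c, hc, rfl⟩
    exact ⟨M.face_mono hTS ⟨c, hc, rfl⟩, hmem c hc⟩

theorem isFace_face [Finite ι] (hTS : T ≤ S) (hT : ∀ j, (T j).Nonempty) :
    IsFace (M.face S) (M.face T) := by
  classical
  cases nonempty_fintype ι
  refine ⟨fun _ => ⟨-∑ j, ∑ k with k ∉ T j, M.coord j k, ?_⟩, ?_⟩
  · symm
    refine M.setOf_forall_le_eq_face hTS hT (B := ∑ j, ∑ k with k ∉ T j, M.off j k)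
      (e := fun j k => if k ∉ T j then 1 else 0) (fun c hc => ?_) (fun j k hk => if_neg (by simpa))
      fun j k _ hk => by simp [hk]
    have hcoord : ∀ j k, M.coord j k (M.toLin c) = c j k - M.off j k := fun j k =>
      eq_sub_of_add_eq (M.coord_toLin c (fun j => (hc j).1) j k)
    simp only [neg_apply, _root_.sum_apply, hcoord, mul_ite,
      mul_one, mul_zero, ← sum_filter, sum_sub_distrib, neg_sub]
  · choose t ht using hT
    exact ⟨_, M.vertex_mem_face_iff.2 ht⟩

theorem apply_toLin_eq_sum [Fintype ι] [DecidableEq ι] [∀ j, DecidableEq (κ j)] (l : E →ₗ[ℝ] ℝ)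
    (c : ∀ j, κ j → ℝ) : l (M.toLin c) =
      ∑ j, ∑ k, c j k * l (M.toLin (Pi.single j (Pi.single k 1))) := by
  have hc : c = ∑ j, ∑ k, c j k • Pi.single j (Pi.single k (1 : ℝ)) := by
    conv_lhs => rw [← univ_sum_single c]
    refine sum_congr rfl fun j _ => ?_
    conv_lhs => rw [← univ_sum_single (c j)]
    simp only [← Pi.single_smul, smul_eq_mul, mul_one]
    exact map_sum (AddMonoidHom.single (fun j => κ j → ℝ) j) _ _
  conv_lhs => rw [hc]
  simp only [map_sum, map_smul, smul_eq_mul]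

theorem exists_face_eq_of_isFace [Finite ι] (hS : ∀ j, (S j).Nonempty) {F : Set E}
    (hF : IsFace (M.face S) F) : ∃ T ≤ S, (∀ j, (T j).Nonempty) ∧ F = M.face T := by
  classical
  cases nonempty_fintype ι
  obtain ⟨l, rfl⟩ := hF.1 hF.2
  let g : ∀ j, κ j → ℝ := fun j k => l (M.toLin (Pi.single j (Pi.single k 1)))
  choose t ht hmax using fun j => exists_max_image (S j) (g j) (hS j)
  let T : ∀ j, Finset (κ j) := fun j => {k ∈ S j | g j k = g j (t j)}
  have hTS : T ≤ S := fun j => filter_subset _ _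
  have hT : ∀ j, (T j).Nonempty := fun j => ⟨t j, mem_filter.2 ⟨ht j, rfl⟩⟩
  refine ⟨T, hTS, hT, M.setOf_forall_le_eq_face hTS hT (B := ∑ j, g j (t j))
    (e := fun j k => g j (t j) - g j k) (fun c hc => ?_)
    (fun j k hk => sub_eq_zero.2 (mem_filter.1 hk).2.symm)
    fun j k hk hkT => sub_pos.2 ((hmax j k hk).lt_of_ne fun h => hkT (mem_filter.2 ⟨hk, h⟩))⟩
  have hsum : ∀ j, ∑ k, c j k = 1 := fun j => (hc j).1.2
  simp only [mul_sub, sum_sub_distrib, ← sum_mul, hsum, one_mul, sub_sub_cancel]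
  exact M.apply_toLin_eq_sum l c

theorem exists_apex_face_eq_vertex [Finite ι] [∀ j, DecidableEq (κ j)] {V : Set E → E}
    (hV : IsApexAssignment M.polytope V) (hS : ∀ j, (S j).Nonempty) :
    ∃ q : ∀ j, κ j, (∀ j, q j ∈ S j) ∧ V (M.face S) = M.vertex q := by
  have hF : IsFace M.polytope (M.face S) :=
    M.face_univ ▸ M.isFace_face (fun j => subset_univ (S j)) hS
  obtain ⟨q, hq⟩ : V (M.face S) ∈ Set.range M.vertex :=
    extremePoints_convexHull_subset <| M.polytope_eq_convexHull ▸
      hF.extremePoints_subset (hV _ hF)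
  exact ⟨q, M.vertex_mem_face_iff.1 (hq ▸ (hV _ hF).1), hq.symm⟩

end Faces

theorem vertex_inf_add_vertex_sup {ι : Type*} {κ : ι → Type*} [∀ j, Fintype (κ j)]
    [∀ j, LinearOrder (κ j)] {E : Type*} [AddCommGroup E] [Module ℝ E] [TopologicalSpace E]
    (M : SimplexProductParam κ E) (a b : ∀ j, κ j) :
    M.vertex (a ⊓ b) + M.vertex (a ⊔ b) = M.vertex a + M.vertex b := by
  simp only [vertex, ← map_add]
  congr 1
  funext j
  rcases le_total (a j) (b j) with h | h
  · simp [h]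
  · simp [h, add_comm]

section Triangulation

variable {ι : Type*} [Fintype ι] [DecidableEq ι] {κ : ι → Type*} [∀ j, Fintype (κ j)]
  [∀ j, LinearOrder (κ j)] {E : Type*} [AddCommGroup E] [Module ℝ E] [TopologicalSpace E]
  (M : SimplexProductParam κ E)

theorem marginal_eq_coord_sum (μ : (∀ j, κ j) → ℝ) (j : ι) (k : κ j) :
    marginal μ j k = M.coord j k (∑ q, μ q • M.vertex q) + M.off j k * ∑ q, μ q := by
  simp [marginal, coord_vertex, mul_sub, mul_sum, mul_comm, sum_filter]

theorem toLin_marginal (μ : (∀ j, κ j) → ℝ) :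
    M.toLin (marginal μ) = ∑ q, μ q • M.vertex q := by
  simp only [vertex, ← map_smul, ← map_sum]
  congr 1
  funext j k
  simp [marginal, Pi.single_apply, sum_filter, eq_comm]

theorem isTriangulationFamily_chainFamily [Nonempty ι] :
    IsTriangulationFamily M.vertex (chainFamily (∀ j, κ j)) where
  isLowerSet _ _ hDC hC := IsChain.mono (coe_subset.2 hDC) hC
  singleton_mem q := by simp [chainFamily]
  hasUniqueWeights C hC D hD μ ν hμ hν hsum hvertex := by
    refine eq_of_marginal_eq hC hD hμ hν (funext fun j => funext fun k => ?_)
    rw [M.marginal_eq_coord_sum, M.marginal_eq_coord_sum, hsum, hvertex]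
  exists_weight x hx := by
    rw [← M.polytope_eq_convexHull] at hx
    obtain ⟨c, hc, rfl⟩ := hx
    obtain ⟨C, μ, hC, hμ, rfl⟩ := exists_isWeightOn_chain c (fun j => (hc j trivial).1) 1
      fun j => (hc j trivial).2
    refine ⟨C, hC, μ, hμ, ?_, (M.toLin_marginal μ).symm⟩
    rw [← sum_marginal μ (Classical.arbitrary ι), (hc _ trivial).2]

end Triangulation

section Staircase

variable {l : ℕ} {d : Fin l → ℕ} {E : Type*} [AddCommGroup E] [Module ℝ E] [TopologicalSpace E]
  (M : SimplexProductParam (fun j => Fin (d j + 1)) E)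

/-- A linear form that separates the vertices, as distinct vertices are mapped to sums of distinct
sets of powers of two, and that increases with the indices of the vertices. -/
def genericForm : E →ₗ[ℝ] ℝ :=
  ∑ j, ∑ k : Fin (d j + 1), (2 ^ Nat.pair k j : ℝ) • (M.coord j k : E →ₗ[ℝ] ℝ)

theorem genericForm_vertex (q : ∀ j, Fin (d j + 1)) : M.genericForm (M.vertex q) =
    ∑ j, (2 ^ Nat.pair (q j) j : ℝ) - ∑ j, ∑ k : Fin (d j + 1), 2 ^ Nat.pair k j * M.off j k := by
  simp [genericForm, coord_vertex, mul_sub, LinearMap.sum_apply, sum_sub_distrib]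

theorem injective_genericForm_vertex : Function.Injective (M.genericForm ∘ M.vertex) := by
  intro q q' h
  have hsum : ∀ q : ∀ j, Fin (d j + 1), ∑ j, 2 ^ Nat.pair (q j) j =
      ∑ i ∈ univ.image fun j => Nat.pair (q j) j, 2 ^ i := fun q =>
    (sum_image fun j _ j' _ he => Fin.ext (Nat.pair_eq_pair.1 he).2).symm
  simp only [Function.comp_apply, genericForm_vertex, sub_left_inj] at h
  have hpow : ∑ j, 2 ^ Nat.pair (q j) j = ∑ j, 2 ^ Nat.pair (q' j) j := by exact_mod_cast h
  rw [hsum, hsum] at hpow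
  exact injective_image_pair (geomSum_injective le_rfl hpow)

theorem genericForm_vertex_mono : Monotone (M.genericForm ∘ M.vertex) := by
  intro q q' h
  simp only [Function.comp_apply, genericForm_vertex]
  refine sub_le_sub_right (sum_le_sum fun j _ => pow_le_pow_right₀ one_le_two ?_) _
  exact (StrictMono.monotone fun _ _ hab => Nat.pair_lt_pair_left _ hab) (h j)

theorem le_of_isMinVertex_genericForm {F : Set E} (hF : IsFace M.polytope F)
    {a b : ∀ j, Fin (d j + 1)} (ha : IsMinVertex M.vertex M.genericForm F a)
    (hb : M.vertex b ∈ F) : a ≤ b := by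
  have hP : ∀ q, M.vertex q ∈ M.polytope := fun q =>
    M.polytope_eq_convexHull ▸ subset_convexHull ℝ _ (Set.mem_range_self q)
  have hinf : M.vertex (a ⊓ b) ∈ F :=
    hF.mem_of_add_eq_add (hP _) (hP _) ha.1 hb (M.vertex_inf_add_vertex_sup a b)
  by_contra hab
  exact (ha.2 _ hinf (mt inf_eq_left.1 hab)).not_ge (M.genericForm_vertex_mono inf_le_left)

theorem exists_isPointedTriangulation_facets_eq [DecidableEq E] {N : ℕ} (hd : ∑ j, d j = N)
    (hN : 1 ≤ N) : ∃ V K, IsPointedTriangulation M.polytope V K ∧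
      K.facets = {s | ∃ (w : Fin N → Fin l) (hw : content w = d),
        (pathChain hw).image M.vertex = s} := by
  have : Nonempty (Fin l) := by
    obtain ⟨j, -, -⟩ := exists_ne_zero_of_sum_ne_zero (hd.trans_ne (by lia))
    exact ⟨j⟩
  have hfam := M.isTriangulationFamily_chainFamily
  obtain ⟨V, hV⟩ := hfam.exists_isPointedTriangulation M.injective_genericForm_vertex (by
    intro F hF a ha C hC hCF
    rw [← M.polytope_eq_convexHull] at hF
    simpa only [chainFamily, Set.mem_ofPred_eq, coe_insert] using
      hC.insert fun b hb _ => .inl (M.le_of_isMinVertex_genericForm hF ha (hCF b hb)))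
  refine ⟨V, hfam.complex, M.polytope_eq_convexHull ▸ hV, ?_⟩
  rw [hfam.facets_complex]
  ext s
  constructor
  · rintro ⟨C, hC, -, rfl⟩
    obtain ⟨w, hw, rfl⟩ := (maximal_chainFamily_iff hd).1 hC
    exact ⟨w, hw, rfl⟩
  · rintro ⟨w, hw, rfl⟩
    exact ⟨_, (maximal_chainFamily_iff hd).2 ⟨w, hw, rfl⟩, univ_nonempty.image _, rfl⟩

end Staircase

end SimplexProductParam

section Binomial

variable {α : Type*} {s : Finset α}

theorem sum_powerset_choose_card (s : Finset α) (n : ℕ) :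
    ∑ t ∈ s.powerset, n.choose #t = (n + 1).multichoose #s := by
  rw [sum_powerset_apply_card, Nat.multichoose_eq, Nat.add_right_comm, Nat.add_sub_cancel,
    Nat.add_choose_eq, Nat.sum_antidiagonal_eq_sum_range_succ_mk]
  refine sum_congr rfl fun i hi => ?_
  rw [smul_eq_mul, mul_comm, Nat.choose_symm (Nat.lt_succ_iff.1 (mem_range.1 hi))]

theorem sum_nonempty_powerset_choose_card_sub_one (hs : s.Nonempty) (n : ℕ) :
    ∑ t ∈ s.powerset with t.Nonempty, n.choose (#t - 1) = (n + 2).multichoose (#s - 1) := by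
  classical
  induction hs using Finset.Nonempty.cons_induction with
  | singleton a =>
    rw [sum_filter, ← insert_empty_eq, sum_powerset_insert (notMem_empty a)]
    simp
  | cons a s has hs ih =>
    have hinsert : ∀ t ∈ s.powerset, n.choose (#(insert a t) - 1) = n.choose #t := fun t ht => by
      rw [card_insert_of_notMem fun hat => has (mem_powerset.1 ht hat), Nat.add_sub_cancel]
    obtain ⟨k, hk⟩ := Nat.exists_eq_add_of_lt hs.card_pos
    rw [sum_filter] at ih
    rw [sum_filter, cons_eq_insert, sum_powerset_insert has, ih]
    simp only [insert_nonempty, if_true, sum_congr rfl hinsert, sum_powerset_choose_card,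
      card_insert_of_notMem has, hk, zero_add, Nat.add_sub_cancel]
    rw [Nat.multichoose_succ_succ (n + 1), add_comm]

theorem sum_powerset_mem_choose_card_sub_one [DecidableEq α] {q : α} (hq : q ∈ s) (n : ℕ) :
    ∑ t ∈ s.powerset with t.Nonempty ∧ q ∈ t, n.choose (#t - 1) =
      (n + 1).multichoose (#s - 1) := by
  rw [← card_erase_of_mem hq, ← sum_powerset_choose_card]
  refine sum_nbij' (fun t => t.erase q) (insert q) (fun t ht => ?_) (fun t ht => ?_)
    (fun t ht => insert_erase (mem_filter.1 ht).2.2)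
    (fun t ht => erase_insert fun h => notMem_erase q s (mem_powerset.1 ht h))
    fun t ht => by rw [card_erase_of_mem (mem_filter.1 ht).2.2]
  · exact mem_powerset.2 (erase_subset_erase q (mem_powerset.1 (mem_filter.1 ht).1))
  · exact mem_filter.2 ⟨mem_powerset.2 (insert_subset hq
      ((mem_powerset.1 ht).trans (erase_subset q s))), insert_nonempty q t, mem_insert_self q t⟩

end Binomial

section Recursion

theorem polytopeDim_eq_zero_iff {E : Type*} [AddCommGroup E] [Module ℝ E] [FiniteDimensional ℝ E]
    {P : Set E} : polytopeDim P = 0 ↔ P.Subsingleton := by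
  rw [polytopeDim, Submodule.finrank_eq_zero, vectorSpan_eq_bot_iff_subsingleton]

theorem finsum_isProperFace_eq_sum {E α : Type*} [AddCommGroup E] [Module ℝ E] [TopologicalSpace E]
    {P : Set E} {A : Finset α} {φ : α → Set E} (hφ : Set.BijOn φ A {F | IsProperFace P F})
    (g : Set E → ℤ) : ∑ᶠ F : {F : Set E // IsProperFace P F}, g F = ∑ a ∈ A, g (φ a) := by
  rw [← finsum_mem_coe_finset, finsum_mem_eq_of_bijOn φ hφ fun a _ => rfl]
  exact finsum_set_coe_eq_finsum_mem _

variable {E : Type*} [AddCommGroup E] [Module ℝ E] [TopologicalSpace E] [FiniteDimensional ℝ E]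

/-- The interior polytope number `P(n)^♯` with respect to the apexes `V`. -/
noncomputable def interiorPolytopeNumber (V : Set E → E) (P : Set E) (n : ℕ) : ℤ :=
  (polytopeNumberPair V P n).2

variable (V : Set E → E) {P : Set E}

theorem polytopeNumber_zero (P : Set E) : polytopeNumber V P 0 = 0 := by
  rw [polytopeNumber, polytopeNumberPair.eq_def]
  simp

theorem polytopeNumber_one (P : Set E) : polytopeNumber V P 1 = 1 := by
  rw [polytopeNumber, polytopeNumberPair.eq_def]
  split_ifs <;> simp_all

theorem polytopeNumber_of_subsingleton (hP : P.Subsingleton) (n : ℕ) :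
    polytopeNumber V P (n + 1) = 1 := by
  rw [polytopeNumber, polytopeNumberPair.eq_def]
  simp [polytopeDim_eq_zero_iff.2 hP]

theorem interiorPolytopeNumber_of_subsingleton (hP : P.Subsingleton) (n : ℕ) :
    interiorPolytopeNumber V P (n + 1) = 1 := by
  rw [interiorPolytopeNumber, polytopeNumberPair.eq_def]
  simp [polytopeDim_eq_zero_iff.2 hP]

variable {α : Type*} {A : Finset α} {φ : α → Set E}

theorem polytopeNumber_add_two_eq_sum [DecidablePred fun a => V P ∈ φ a] (hP : ¬P.Subsingleton)
    (hφ : Set.BijOn φ A {F | IsProperFace P F}) (n : ℕ) :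
    polytopeNumber V P (n + 2) = polytopeNumber V P (n + 1) +
      ∑ a ∈ A with V P ∉ φ a, interiorPolytopeNumber V (φ a) (n + 2) := by
  classical
  rw [polytopeNumber, polytopeNumberPair.eq_def]
  simp only [polytopeDim_eq_zero_iff, hP, if_false]
  rw [finsum_isProperFace_eq_sum hφ fun F =>
    if V P ∈ F then 0 else (polytopeNumberPair V F (n + 2)).2, sum_filter]
  simp only [ite_not, polytopeNumber, interiorPolytopeNumber]
  congr!

theorem interiorPolytopeNumber_add_two_eq_sub (hP : ¬P.Subsingleton)
    (hφ : Set.BijOn φ A {F | IsProperFace P F}) (n : ℕ) :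
    interiorPolytopeNumber V P (n + 2) = polytopeNumber V P (n + 2) -
      ∑ a ∈ A, interiorPolytopeNumber V (φ a) (n + 2) := by
  rw [interiorPolytopeNumber, polytopeNumber, polytopeNumberPair.eq_def]
  simp only [polytopeDim_eq_zero_iff, hP, if_false]
  rw [finsum_isProperFace_eq_sum hφ fun F => (polytopeNumberPair V F (n + 2)).2]
  rfl

end Recursion

namespace SimplexProductParam

section Subtuples

variable {ι : Type*} [Fintype ι] [DecidableEq ι] {κ : ι → Type*} {S T : ∀ j, Finset (κ j)}

/-- The tuples of nonempty subsets of the `S j`, which index the faces of `face S`. -/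
def subtuples (S : ∀ j, Finset (κ j)) : Finset (∀ j, Finset (κ j)) :=
  Fintype.piFinset fun j => {t ∈ (S j).powerset | t.Nonempty}

theorem mem_subtuples : T ∈ subtuples S ↔ T ≤ S ∧ ∀ j, (T j).Nonempty := by
  simp [subtuples, forall_and, Pi.le_def]

theorem sum_subtuples (hS : ∀ j, (S j).Nonempty) (n : ℕ) :
    ∑ T ∈ subtuples S, ∏ j, n.choose (#(T j) - 1) = ∏ j, (n + 2).multichoose (#(S j) - 1) := by
  rw [subtuples, ← prod_univ_sum (fun j => {t ∈ (S j).powerset | t.Nonempty})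
    fun _ t => n.choose (#t - 1)]
  exact prod_congr rfl fun j _ => sum_nonempty_powerset_choose_card_sub_one (hS j) n

theorem sum_subtuples_mem [∀ j, DecidableEq (κ j)] {q : ∀ j, κ j} (hq : ∀ j, q j ∈ S j) (n : ℕ) :
    ∑ T ∈ subtuples S with ∀ j, q j ∈ T j, ∏ j, n.choose (#(T j) - 1) =
      ∏ j, (n + 1).multichoose (#(S j) - 1) := by
  have hfilter : {T ∈ subtuples S | ∀ j, q j ∈ T j} =
      Fintype.piFinset fun j => {t ∈ (S j).powerset | t.Nonempty ∧ q j ∈ t} := by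
    ext T
    simp [subtuples, forall_and, and_assoc]
  rw [hfilter, ← prod_univ_sum (fun j => {t ∈ (S j).powerset | t.Nonempty ∧ q j ∈ t})
    fun _ t => n.choose (#t - 1)]
  exact prod_congr rfl fun j _ => sum_powerset_mem_choose_card_sub_one (hq j) n

end Subtuples

section Numbers

variable {ι : Type*} [Fintype ι] {κ : ι → Type*} [∀ j, Fintype (κ j)] {E : Type*}
  [AddCommGroup E] [Module ℝ E] [TopologicalSpace E] (M : SimplexProductParam κ E)
  {S : ∀ j, Finset (κ j)}

theorem bijOn_face [DecidableEq ι] [∀ j, DecidableEq (κ j)] (hS : ∀ j, (S j).Nonempty) :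
    Set.BijOn M.face ((subtuples S).erase S : Finset _) {F | IsProperFace (M.face S) F} := by
  refine ⟨fun T hT => ?_, M.injOn_face.mono fun T hT =>
    (mem_subtuples.1 (mem_of_mem_erase (mem_coe.1 hT))).2, fun F hF => ?_⟩
  · obtain ⟨hne, hT⟩ := mem_erase.1 (mem_coe.1 hT)
    obtain ⟨hTS, hT⟩ := mem_subtuples.1 hT
    exact ⟨M.isFace_face hTS hT, fun h => hne (M.injOn_face hT hS h)⟩
  · obtain ⟨T, hTS, hT, rfl⟩ := M.exists_face_eq_of_isFace hS hF.1
    refine ⟨T, mem_coe.2 (mem_erase.2 ⟨?_, mem_subtuples.2 ⟨hTS, hT⟩⟩), rfl⟩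
    rintro rfl
    exact hF.2 rfl

variable [FiniteDimensional ℝ E] {V : Set E → E}

theorem polytopeNumber_face_of_interior [DecidableEq ι] [∀ j, DecidableEq (κ j)]
    (hV : IsApexAssignment M.polytope V) (hS : ∀ j, (S j).Nonempty)
    (hint : ∀ T ∈ (subtuples S).erase S, ∀ n,
      interiorPolytopeNumber V (M.face T) (n + 2) = (∏ j, n.choose (#(T j) - 1) : ℕ)) (n : ℕ) :
    polytopeNumber V (M.face S) (n + 1) = (∏ j, (n + 1).multichoose (#(S j) - 1) : ℕ) := by
  by_cases hsub : (M.face S).Subsingleton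
  · simp [polytopeNumber_of_subsingleton V hsub, (M.face_subsingleton_iff hS).1 hsub]
  obtain ⟨q, hq, hVq⟩ := M.exists_apex_face_eq_vertex hV hS
  induction n with
  | zero => simp [polytopeNumber_one]
  | succ n ih =>
    have : DecidablePred fun T => V (M.face S) ∈ M.face T := Classical.decPred _
    have hsum := sum_filter_add_sum_filter_not (subtuples S) (fun T => ∀ j, q j ∈ T j)
      fun T => ∏ j, n.choose (#(T j) - 1)
    have herase : {T ∈ (subtuples S).erase S | ¬∀ j, q j ∈ T j} =
        {T ∈ subtuples S | ¬∀ j, q j ∈ T j} := by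
      rw [filter_erase, erase_eq_of_notMem (by simp [hq])]
    rw [sum_subtuples hS, sum_subtuples_mem hq, ← herase] at hsum
    rw [polytopeNumber_add_two_eq_sum V hsub (M.bijOn_face hS), ih, ← hsum, Nat.cast_add,
      Nat.cast_sum]
    simp only [hVq, M.vertex_mem_face_iff]
    exact congrArg _ (sum_congr rfl fun T hT => hint T (mem_of_mem_filter T hT) n)

theorem interiorPolytopeNumber_face (hV : IsApexAssignment M.polytope V)
    (hS : ∀ j, (S j).Nonempty) (n : ℕ) :
    interiorPolytopeNumber V (M.face S) (n + 2) = (∏ j, n.choose (#(S j) - 1) : ℕ) := by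
  classical
  induction S using WellFoundedLT.induction generalizing n with
  | ind S ih =>
  by_cases hsub : (M.face S).Subsingleton
  · simp [interiorPolytopeNumber_of_subsingleton V hsub, (M.face_subsingleton_iff hS).1 hsub]
  have hint : ∀ T ∈ (subtuples S).erase S, ∀ n,
      interiorPolytopeNumber V (M.face T) (n + 2) = (∏ j, n.choose (#(T j) - 1) : ℕ) := by
    intro T hT n
    obtain ⟨hne, hT⟩ := mem_erase.1 hT
    obtain ⟨hTS, hT⟩ := mem_subtuples.1 hT
    exact ih T (lt_of_le_of_ne hTS hne) hT n
  rw [interiorPolytopeNumber_add_two_eq_sub V hsub (M.bijOn_face hS),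
    M.polytopeNumber_face_of_interior hV hS hint, ← sum_subtuples hS,
    ← add_sum_erase _ _ (mem_subtuples.2 ⟨le_rfl, hS⟩), sum_congr rfl fun T hT => hint T hT n]
  push_cast
  exact add_sub_cancel_right _ _

theorem polytopeNumber_polytope [∀ j, Nonempty (κ j)] (hV : IsApexAssignment M.polytope V)
    (n : ℕ) : polytopeNumber V M.polytope (n + 1) =
      (∏ j, (n + 1).multichoose (Fintype.card (κ j) - 1) : ℕ) := by
  classical
  rw [← M.face_univ, M.polytopeNumber_face_of_interior hV (fun j => univ_nonempty)]
  · simp only [card_univ]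
  · exact fun T hT => M.interiorPolytopeNumber_face hV (mem_subtuples.1 (mem_of_mem_erase hT)).2

end Numbers

end SimplexProductParam

section StandardSimplex

/-- The standard simplex, parametrized by itself as a product with one factor. -/
noncomputable def stdSimplexParam (N : ℕ) :
    SimplexProductParam (fun _ : Unit => Fin (N + 1)) (Fin (N + 1) → ℝ) where
  toLin := LinearMap.proj ()
  coord _ k := ContinuousLinearMap.proj k
  off _ _ := 0
  coord_toLin c _ j k := by simp

theorem stdSimplexParam_polytope (N : ℕ) :
    (stdSimplexParam N).polytope = stdSimplex ℝ (Fin (N + 1)) :=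
  Set.eval_image_univ_pi ⟨_, fun _ _ => single_mem_stdSimplex ℝ 0⟩

theorem polytopeNumber_stdSimplex {N : ℕ} (hN : 1 ≤ N)
    {W : Set (Fin (N + 1) → ℝ) → Fin (N + 1) → ℝ}
    (hW : IsApexAssignment (stdSimplex ℝ (Fin (N + 1))) W) (n : ℕ) :
    polytopeNumber W (stdSimplex ℝ (Fin (N + 1))) n = n.multichoose N := by
  rw [← stdSimplexParam_polytope] at hW ⊢
  cases n with
  | zero => obtain ⟨N, rfl⟩ := Nat.exists_eq_add_of_le' hN; simp [polytopeNumber_zero]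
  | succ n => simp [(stdSimplexParam N).polytopeNumber_polytope hW]

end StandardSimplex

section Worpitzky

variable {l N : ℕ}

/-- The number of descents of the word `w` with a letter `t` put in front of it. -/
def descentCountFrom (w : Fin N → Fin l) (t : ℕ) : ℕ :=
  descentCount w + #{k : Fin N | (k : ℕ) = 0 ∧ (w k : ℕ) < t}

theorem descentCountFrom_zero (w : Fin N → Fin l) : descentCountFrom w 0 = descentCount w := by
  simp [descentCountFrom]

theorem content_cons (c : Fin l) (w : Fin N → Fin l) :
    content (Fin.cons c w : Fin (N + 1) → Fin l) = content w + Pi.single c 1 := by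
  funext j
  simp only [content, card_filter, Fin.sum_univ_succ, Fin.cons_zero, Fin.cons_succ, Pi.add_apply,
    Pi.single_apply]
  rw [add_comm]
  simp only [eq_comm]

theorem descentCount_cons (c : Fin l) (w : Fin N → Fin l) :
    descentCount (Fin.cons c w : Fin (N + 1) → Fin l) = descentCountFrom w c := by
  simp only [descentCountFrom, descentCount, card_filter, ← univ_product_univ, sum_product,
    Fin.sum_univ_succ, Fin.cons_zero, Fin.cons_succ, Fin.val_zero, Fin.val_succ, zero_add,
    Nat.add_right_cancel_iff, Fin.lt_def]
  simp [add_comm]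

theorem descentCountFrom_cons (c : Fin l) (w : Fin N → Fin l) (t : ℕ) :
    descentCountFrom (Fin.cons c w : Fin (N + 1) → Fin l) t =
      descentCountFrom w c + if (c : ℕ) < t then 1 else 0 := by
  rw [descentCountFrom, descentCount_cons, card_filter, Fin.sum_univ_succ]
  simp

theorem descentCountFrom_le (w : Fin N → Fin l) (t : ℕ) : descentCountFrom w t ≤ N := by
  induction N generalizing t with
  | zero => simp [descentCountFrom, descentCount]
  | succ N ih =>
    rw [← Fin.cons_self_tail w, descentCountFrom_cons]
    exact add_le_add (ih _ _) (by split_ifs <;> simp)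

theorem descentCount_lt (hN : 1 ≤ N) (w : Fin N → Fin l) : descentCount w < N := by
  obtain ⟨N, rfl⟩ := Nat.exists_eq_add_of_le' hN
  rw [← Fin.cons_self_tail w, descentCount_cons]
  exact Nat.lt_succ_of_le (descentCountFrom_le _ _)

theorem multichoose_sub_succ {i n : ℕ} (hi : i ≤ n + N) : (n + 1 - i).multichoose (N + 1) =
    (n - i).multichoose (N + 1) + (n + 1 - i).multichoose N := by
  rcases Nat.lt_or_ge n i with hn | hn
  · obtain ⟨N, rfl⟩ := Nat.exists_eq_add_of_lt (by lia : 0 < N)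
    simp [Nat.sub_eq_zero_of_le hn.le, Nat.sub_eq_zero_of_le (Nat.succ_le_of_lt hn)]
  · rw [Nat.sub_add_comm hn, Nat.multichoose_succ_succ]

/-- The sum of the `N`-dimensional simplex numbers with index `m + 1 - des w` over the words `w` of
length `N` and content `d`, where `des` counts descents after a letter `t` has been put in front. -/
def wordSum (N : ℕ) (d : Fin l → ℕ) (m t : ℕ) : ℕ :=
  ∑ w : Fin N → Fin l with content w = d, (m + 1 - descentCountFrom w t).multichoose N

theorem wordSum_succ (d : Fin l → ℕ) (m t : ℕ) : wordSum (N + 1) d m t =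
    ∑ c : Fin l, ∑ w : Fin N → Fin l with content w + Pi.single c 1 = d,
      (m + 1 - (descentCountFrom w c + if (c : ℕ) < t then 1 else 0)).multichoose (N + 1) := by
  have hcons : ∀ (c : Fin l) (w : Fin N → Fin l),
      Fin.consEquiv (fun _ => Fin l) (c, w) = Fin.cons c w := fun _ _ => rfl
  rw [wordSum, sum_filter, ← (Fin.consEquiv fun _ => Fin l).sum_comp, Fintype.sum_prod_type]
  simp only [hcons, content_cons, descentCountFrom_cons, sum_filter]

theorem wordSum_succ_top (d : Fin l → ℕ) (m : ℕ) :
    wordSum (N + 1) d (m + 1) l = wordSum (N + 1) d m 0 := by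
  simp only [wordSum_succ, Fin.is_lt, if_true, Nat.not_lt_zero, if_false, Nat.add_sub_add_right,
    add_zero]

theorem wordSum_zero_top (d : Fin l → ℕ) : wordSum (N + 1) d 0 l = 0 := by
  simp [wordSum_succ]

theorem wordSum_succ_eq_add (d : Fin l → ℕ) (m : ℕ) (t : Fin l) :
    wordSum (N + 1) d m t = wordSum (N + 1) d m (t + 1) +
      ∑ w : Fin N → Fin l with content w + Pi.single t 1 = d,
        (m + 1 - descentCountFrom w t).multichoose N := by
  rw [wordSum_succ, wordSum_succ, ← add_sum_erase _ _ (mem_univ t),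
    ← add_sum_erase univ (fun c => ∑ w : Fin N → Fin l with _, _) (mem_univ t), add_right_comm,
    ← sum_add_distrib]
  congr 1
  · refine sum_congr rfl fun w _ => ?_
    rw [if_neg (lt_irrefl _), if_pos (Nat.lt_succ_self _), Nat.add_sub_add_right]
    exact multichoose_sub_succ (le_add_left (descentCountFrom_le w t))
  · refine sum_congr rfl fun c hc => ?_
    have hlt : (c : ℕ) < t + 1 ↔ (c : ℕ) < t :=
      Nat.lt_succ_iff_lt_or_eq.trans (or_iff_left (Fin.val_ne_of_ne (ne_of_mem_erase hc)))
    simp only [hlt]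

/-- The value of `wordSum` when `d` sums to `N`: a product with one simplex number for each letter,
whose index depends on the position of the letter relative to the threshold `t`. -/
def multichooseProd (d : Fin l → ℕ) (m t : ℕ) : ℕ :=
  ∏ j : Fin l, (if (j : ℕ) < t then m else m + 1).multichoose (d j)

theorem multichooseProd_succ_top (d : Fin l → ℕ) (m : ℕ) :
    multichooseProd d (m + 1) l = multichooseProd d m 0 := by
  simp [multichooseProd]

theorem multichooseProd_zero_top {d : Fin l → ℕ} (hd : d ≠ 0) : multichooseProd d 0 l = 0 := by
  obtain ⟨j, hj⟩ := Function.ne_iff.1 hd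
  obtain ⟨k, hk⟩ := Nat.exists_eq_succ_of_ne_zero hj
  exact prod_eq_zero (mem_univ j) (by simp [hk])

theorem multichooseProd_eq_of_eq_zero {d : Fin l → ℕ} {t : Fin l} (ht : d t = 0) (m : ℕ) :
    multichooseProd d m t = multichooseProd d m (t + 1) := by
  refine prod_congr rfl fun j _ => ?_
  rcases eq_or_ne j t with rfl | hj
  · simp [ht]
  · simp only [Nat.lt_succ_iff_lt_or_eq, Fin.val_ne_of_ne hj, or_false]

theorem multichooseProd_add_single (d : Fin l → ℕ) (t : Fin l) (m : ℕ) :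
    multichooseProd (d + Pi.single t 1) m t =
      multichooseProd (d + Pi.single t 1) m (t + 1) + multichooseProd d m t := by
  have hd : ∀ j ∈ univ.erase t, (d + Pi.single t 1 : Fin l → ℕ) j = d j := fun j hj => by
    simp [ne_of_mem_erase hj]
  have hlt : ∀ j ∈ univ.erase t, ((j : ℕ) < t + 1 ↔ (j : ℕ) < t) := fun j hj =>
    Nat.lt_succ_iff_lt_or_eq.trans (or_iff_left (Fin.val_ne_of_ne (ne_of_mem_erase hj)))
  have hold := prod_congr rfl fun (j : Fin l) hj =>
    congrArg (if (j : ℕ) < t then m else m + 1).multichoose (hd j hj)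
  have hnew := prod_congr rfl fun (j : Fin l) hj =>
    congrArg₂ Nat.multichoose (if_congr (hlt j hj) (Eq.refl m) (Eq.refl (m + 1))) (hd j hj)
  simp only [multichooseProd, ← mul_prod_erase univ _ (mem_univ t)]
  rw [hold, hnew, ← add_mul]
  simp [Nat.multichoose_succ_succ]

theorem wordSum_eq_multichooseProd_of_top {d : Fin l → ℕ} (hd : ∑ j, d j = N + 1) {m : ℕ}
    (ih : ∀ e : Fin l → ℕ, ∑ j, e j = N → ∀ t ≤ l, wordSum N e m t = multichooseProd e m t)
    (htop : wordSum (N + 1) d m l = multichooseProd d m l) {t : ℕ} (ht : t ≤ l) :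
    wordSum (N + 1) d m t = multichooseProd d m t := by
  induction ht using Nat.decreasingInduction with
  | self => exact htop
  | of_succ t ht iht =>
    have hstep := wordSum_succ_eq_add (N := N) d m ⟨t, ht⟩
    rw [iht] at hstep
    rw [hstep]
    by_cases hzero : d ⟨t, ht⟩ = 0
    · rw [← multichooseProd_eq_of_eq_zero hzero, filter_false_of_mem, sum_empty, add_zero]
      rintro w - rfl
      simp at hzero
    · obtain ⟨e, hde⟩ : ∃ e : Fin l → ℕ, d = e + Pi.single (⟨t, ht⟩ : Fin l) 1 :=
        ⟨d - Pi.single ⟨t, ht⟩ 1, (tsub_add_cancel_of_le (update_le_iff.2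
          ⟨Nat.one_le_iff_ne_zero.2 hzero, fun _ _ => Nat.zero_le _⟩)).symm⟩
      subst hde
      have he : ∑ j, e j = N := by simpa [sum_add_distrib] using hd
      simp only [add_left_inj]
      rw [← wordSum, ih e he t ht.le]
      exact (multichooseProd_add_single e ⟨t, ht⟩ m).symm

theorem wordSum_eq_multichooseProd {d : Fin l → ℕ} (hd : ∑ j, d j = N) (m : ℕ) {t : ℕ}
    (ht : t ≤ l) : wordSum N d m t = multichooseProd d m t := by
  induction N generalizing d m t with
  | zero =>
    obtain rfl : d = 0 := funext fun j => sum_eq_zero_iff.1 hd j (mem_univ j)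
    have hcontent : ∀ w : Fin 0 → Fin l, content w = 0 := fun w => funext fun j => by simp [content]
    simp [wordSum, multichooseProd, hcontent]
  | succ N ihN =>
    induction m generalizing t with
    | zero =>
      have hd0 : d ≠ 0 := by
        rintro rfl
        simp at hd
      exact wordSum_eq_multichooseProd_of_top hd (fun e he t ht => ihN he 0 ht)
        ((wordSum_zero_top d).trans (multichooseProd_zero_top hd0).symm) ht
    | succ m ihm =>
      refine wordSum_eq_multichooseProd_of_top hd (fun e he t ht => ihN he (m + 1) ht) ?_ ht
      rw [wordSum_succ_top, multichooseProd_succ_top, ihm (Nat.zero_le l)]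

/-- MacMahon's generalization of the Worpitzky identity from permutations to multisets. -/
theorem sum_content_multichoose {d : Fin l → ℕ} (hd : ∑ j, d j = N) (n : ℕ) :
    ∑ w : Fin N → Fin l with content w = d, (n + 1 - descentCount w).multichoose N =
      ∏ j, (n + 1).multichoose (d j) := by
  simpa only [wordSum, descentCountFrom_zero, multichooseProd, Nat.not_lt_zero, if_false] using
    wordSum_eq_multichooseProd hd n (Nat.zero_le l)

theorem sum_card_descentCount_mul (hN : 1 ≤ N) (d : Fin l → ℕ) (f : ℕ → ℕ) :
    ∑ i ∈ range N, #{w : Fin N → Fin l | content w = d ∧ descentCount w = i} * f i =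
      ∑ w : Fin N → Fin l with content w = d, f (descentCount w) := by
  rw [← sum_fiberwise_of_maps_to fun w _ => mem_range.2 (descentCount_lt hN w)]
  refine sum_congr rfl fun i _ => ?_
  rw [filter_filter, ← smul_eq_mul, ← sum_const]
  exact sum_congr rfl fun w hw => by rw [(mem_filter.1 hw).2.2]

theorem SimplexProductParam.polytopeNumber_polytope_eq_sum {E : Type*} [AddCommGroup E]
    [Module ℝ E] [TopologicalSpace E] [FiniteDimensional ℝ E] {d : Fin l → ℕ}
    (M : SimplexProductParam (fun j => Fin (d j + 1)) E) (hd : ∑ j, d j = N) (hN : 1 ≤ N)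
    {V : Set E → E} (hV : IsApexAssignment M.polytope V)
    {W : Set (Fin (N + 1) → ℝ) → Fin (N + 1) → ℝ}
    (hW : IsApexAssignment (stdSimplex ℝ (Fin (N + 1))) W) (n : ℕ) :
    polytopeNumber V M.polytope n = ∑ i ∈ range N,
      (#{w : Fin N → Fin l | content w = d ∧ descentCount w = i} : ℤ) *
        polytopeNumber W (stdSimplex ℝ (Fin (N + 1))) (n - i) := by
  cases n with
  | zero => simp [polytopeNumber_zero]
  | succ n =>
    simp only [M.polytopeNumber_polytope hV, polytopeNumber_stdSimplex hN hW, Fintype.card_fin,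
      Nat.add_sub_cancel]
    rw [← sum_content_multichoose hd, ← sum_card_descentCount_mul hN d fun i =>
      (n + 1 - i).multichoose N]
    push_cast
    rfl

end Worpitzky

section SimplexProducts

variable {l : ℕ} (d : Fin l → ℕ)

/-- The product of standard simplices, parametrized by itself. -/
noncomputable def simplexProductParam : SimplexProductParam (fun j => Fin (d j + 1))
    ((j : Fin l) → Fin (d j + 1) → ℝ) where
  toLin := LinearMap.id
  coord j k := (ContinuousLinearMap.proj (R := ℝ) (φ := fun _ : Fin (d j + 1) => ℝ) k).comp
    (ContinuousLinearMap.proj (R := ℝ) (φ := fun j => Fin (d j + 1) → ℝ) j)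
  off _ _ := 0
  coord_toLin c _ j k := by simp

theorem simplexProductParam_polytope : (simplexProductParam d).polytope = simplexProduct d := by
  simp [SimplexProductParam.polytope, simplexProductParam, simplexProduct]

variable {d}

theorem isMultisetPerm_iff_content_eq {w : Fin (∑ j, d j) → Fin l} :
    IsMultisetPerm d w ↔ content w = d :=
  funext_iff.symm

theorem image_pathChain_simplexProductParam {w : Fin (∑ j, d j) → Fin l} (hw : content w = d) :
    (pathChain hw).image (simplexProductParam d).vertex = productSimplex d w := by
  rw [pathChain, image_image, productSimplex]
  congr 1
  funext i j k
  simp [SimplexProductParam.vertex, simplexProductParam, Pi.single_apply, pathPoint, prefixCount,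
    Fin.ext_iff]

theorem exists_isPointedTriangulation_simplexProduct (hd : 1 ≤ ∑ j, d j) :
    ∃ V K, IsPointedTriangulation (simplexProduct d) V K ∧
      K.facets = {s | ∃ w, IsMultisetPerm d w ∧ s = productSimplex d w} := by
  obtain ⟨V, K, hK, hfacets⟩ :=
    (simplexProductParam d).exists_isPointedTriangulation_facets_eq rfl hd
  refine ⟨V, K, simplexProductParam_polytope d ▸ hK, ?_⟩
  simp only [hfacets, image_pathChain_simplexProductParam, isMultisetPerm_iff_content_eq,
    exists_prop, eq_comm]

theorem polytopeNumber_simplexProduct (hd : 1 ≤ ∑ j, d j)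
    {V : Set ((j : Fin l) → Fin (d j + 1) → ℝ) → (j : Fin l) → Fin (d j + 1) → ℝ}
    (hV : IsApexAssignment (simplexProduct d) V)
    {W : Set (Fin ((∑ j, d j) + 1) → ℝ) → Fin ((∑ j, d j) + 1) → ℝ}
    (hW : IsApexAssignment (stdSimplex ℝ (Fin ((∑ j, d j) + 1))) W) (n : ℕ) :
    polytopeNumber V (simplexProduct d) n = ∑ i ∈ range (∑ j, d j),
      (generalizedEulerianNumber d i : ℤ) *
        polytopeNumber W (stdSimplex ℝ (Fin ((∑ j, d j) + 1))) (n - i) := by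
  rw [← simplexProductParam_polytope] at hV ⊢
  rw [(simplexProductParam d).polytopeNumber_polytope_eq_sum rfl hd hV hW]
  simp only [generalizedEulerianNumber, isMultisetPerm_iff_content_eq]

end SimplexProducts

section Boxes

variable {d : ℕ} {a b : Fin d → ℝ}

/-- A box, parametrized by a product of one-dimensional standard simplices. -/
noncomputable def boxParam (h : ∀ i, a i < b i) :
    SimplexProductParam (fun _ : Fin d => Fin (1 + 1)) (Fin d → ℝ) where
  toLin := LinearMap.pi fun j => (a j • LinearMap.proj 0 + b j • LinearMap.proj 1) ∘ₗ
    LinearMap.proj (R := ℝ) (φ := fun _ => Fin (1 + 1) → ℝ) j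
  coord j k := (if k = 0 then -(b j - a j)⁻¹ else (b j - a j)⁻¹) • ContinuousLinearMap.proj j
  off j k := if k = 0 then (b j - a j)⁻¹ * b j else -((b j - a j)⁻¹ * a j)
  coord_toLin c hc j k := by
    have hsum : c j 0 + c j 1 = 1 := by simpa [Fin.sum_univ_two] using (hc j).2
    have hab : b j - a j ≠ 0 := (sub_pos.2 (h j)).ne'
    obtain hc0 : c j 0 = 1 - c j 1 := eq_sub_of_add_eq hsum
    fin_cases k <;> simp [hc0] <;> field_simp <;> ring

theorem boxParam_vertex_apply (h : ∀ i, a i < b i) (s : Fin d → Fin (1 + 1)) (j : Fin d) :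
    (boxParam h).vertex s j = if s j = 0 then a j else b j := by
  rcases Fin.exists_fin_two.1 ⟨s j, rfl⟩ with hs | hs <;>
    simp [SimplexProductParam.vertex, boxParam, hs]

theorem range_boxParam_vertex (h : ∀ i, a i < b i) :
    Set.range (boxParam h).vertex = Set.univ.pi fun j => {a j, b j} := by
  ext x
  constructor
  · rintro ⟨s, rfl⟩ j -
    rw [boxParam_vertex_apply]
    split_ifs <;> simp
  · intro hx
    refine ⟨fun j => if x j = a j then 0 else 1, funext fun j => ?_⟩
    rw [boxParam_vertex_apply]
    rcases hx j trivial with hj | hj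
    · simp [show x j = a j from hj]
    · simp [Set.mem_singleton_iff.1 hj, (h j).ne']

theorem boxParam_polytope (h : ∀ i, a i < b i) : (boxParam h).polytope = measurePolytope a b := by
  rw [SimplexProductParam.polytope_eq_convexHull, range_boxParam_vertex, convexHull_pi]
  simp only [convexHull_pair, segment_eq_Icc (h _).le, measurePolytope]

theorem content_eq_one_iff_bijective {w : Fin d → Fin d} :
    content w = (fun _ => 1) ↔ Function.Bijective w := by
  simp only [funext_iff, content, Function.bijective_iff_existsUnique,
    Fintype.existsUnique_iff_card_one]

theorem content_eq_one (σ : Equiv.Perm (Fin d)) : content σ = fun _ => 1 :=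
  content_eq_one_iff_bijective.2 σ.bijective

theorem prefixCount_perm (σ : Equiv.Perm (Fin d)) (i : ℕ) (j : Fin d) :
    prefixCount σ i j = if (σ.symm j : ℕ) < i then 1 else 0 := by
  simp only [prefixCount, ← Equiv.eq_symm_apply]
  rw [filter_and, filter_eq', if_pos (mem_univ _), inter_singleton]
  split_ifs <;> simp_all

theorem image_pathChain_boxParam (h : ∀ i, a i < b i) (σ : Equiv.Perm (Fin d)) :
    (pathChain (content_eq_one σ)).image (boxParam h).vertex = boxSimplex a b σ := by
  rw [pathChain, image_image, boxSimplex]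
  congr 1
  funext i j
  simp only [Function.comp_apply, boxParam_vertex_apply, pathPoint, prefixCount_perm, Fin.ext_iff]
  split_ifs <;> simp_all

theorem exists_isPointedTriangulation_measurePolytope (hd : 1 ≤ d) (h : ∀ i, a i < b i) :
    ∃ V K, IsPointedTriangulation (measurePolytope a b) V K ∧
      K.facets = {s | ∃ σ : Equiv.Perm (Fin d), s = boxSimplex a b σ} := by
  obtain ⟨V, K, hK, hfacets⟩ :=
    (boxParam h).exists_isPointedTriangulation_facets_eq (d := fun _ => 1) (by simp) hd
  refine ⟨V, K, boxParam_polytope h ▸ hK, hfacets.trans (Set.ext fun s => ⟨?_, ?_⟩)⟩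
  · rintro ⟨w, hw, rfl⟩
    exact ⟨.ofBijective w (content_eq_one_iff_bijective.1 hw),
      image_pathChain_boxParam h (.ofBijective w _)⟩
  · rintro ⟨σ, rfl⟩
    exact ⟨σ, content_eq_one σ, image_pathChain_boxParam h σ⟩

theorem eulerianNumber_eq_card (i : ℕ) : eulerianNumber d i =
    #{w : Fin d → Fin d | content w = (fun _ => 1) ∧ descentCount w = i} := by
  refine card_bij (fun σ _ => σ) (fun σ hσ => ?_) (fun σ _ τ _ h => DFunLike.coe_injective h)
    fun w hw => ?_
  · simpa [content_eq_one] using hσ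
  · obtain ⟨-, hcontent, hdes⟩ := mem_filter.1 hw
    exact ⟨.ofBijective w (content_eq_one_iff_bijective.1 hcontent), by simpa using hdes, rfl⟩

theorem polytopeNumber_measurePolytope (hd : 1 ≤ d) (h : ∀ i, a i < b i)
    {V : Set (Fin d → ℝ) → Fin d → ℝ} (hV : IsApexAssignment (measurePolytope a b) V)
    {W : Set (Fin (d + 1) → ℝ) → Fin (d + 1) → ℝ}
    (hW : IsApexAssignment (stdSimplex ℝ (Fin (d + 1))) W) (n : ℕ) :
    polytopeNumber V (measurePolytope a b) n = ∑ i ∈ range d,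
      (eulerianNumber d i : ℤ) * polytopeNumber W (stdSimplex ℝ (Fin (d + 1))) (n - i) := by
  rw [← boxParam_polytope h] at hV ⊢
  simp only [(boxParam h).polytopeNumber_polytope_eq_sum (d := fun _ => 1) (by simp) hd hV hW,
    eulerianNumber_eq_card]

end Boxes

section CrossTriangulation

variable {d : ℕ}

/-- The vertex `±e_i` of the cross polytope, given by the index and the sign. -/
def crossVertex (q : Fin d × ℤˣ) : Fin d → ℝ := Pi.single q.1 ((q.2 : ℤ) : ℝ)

theorem crossPolytope_eq_convexHull : crossPolytope d = convexHull ℝ (Set.range crossVertex) := by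
  rw [crossPolytope]
  congr 1
  ext x
  constructor
  · rintro (⟨i, rfl⟩ | ⟨i, rfl⟩)
    exacts [⟨(i, 1), by simp [crossVertex]⟩, ⟨(i, -1), by simp [crossVertex, Pi.single_neg]⟩]
  · rintro ⟨⟨i, s⟩, rfl⟩
    rcases Int.units_eq_one_or s with rfl | rfl
    exacts [.inl ⟨i, by simp [crossVertex]⟩, .inr ⟨i, by simp [crossVertex, Pi.single_neg]⟩]

theorem crossVertex_mem_crossPolytope (q : Fin d × ℤˣ) : crossVertex q ∈ crossPolytope d :=
  crossPolytope_eq_convexHull ▸ subset_convexHull ℝ _ (Set.mem_range_self q)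

theorem sum_prod_units (μ : Fin d × ℤˣ → ℝ) : ∑ q, μ q = ∑ i, (μ (i, 1) + μ (i, -1)) := by
  rw [Fintype.sum_prod_type]
  exact sum_congr rfl fun i _ => by rw [UnitsInt.univ, sum_pair (by decide)]

theorem sum_smul_crossVertex (μ : Fin d × ℤˣ → ℝ) (i : Fin d) :
    (∑ q, μ q • crossVertex q) i = μ (i, 1) - μ (i, -1) := by
  rw [Finset.sum_apply, sum_prod_units fun q => (μ q • crossVertex q) i, sub_eq_add_neg]
  simp [crossVertex, Pi.single_apply, sum_add_distrib]

theorem sum_abs_le_one_of_mem_crossPolytope {x : Fin d → ℝ} (hx : x ∈ crossPolytope d) :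
    ∑ i, |x i| ≤ 1 := by
  rw [crossPolytope_eq_convexHull] at hx
  obtain ⟨μ, hμ, hμ1, rfl⟩ := mem_convexHull_range_iff.1 hx
  rw [← hμ1, sum_prod_units]
  refine sum_le_sum fun i _ => ?_
  rw [sum_smul_crossVertex]
  have hpos : 0 ≤ μ (i, 1) := hμ _
  have hneg : 0 ≤ μ (i, -1) := hμ _
  exact abs_sub_le_iff.2 ⟨by linarith, by linarith⟩

/-- The vertex sets of the simplices of the triangulation of the cross polytope: they contain no
two opposite vertices, except possibly those on the last axis. -/
def crossFamily (d : ℕ) : Set (Finset (Fin (d + 1) × ℤˣ)) :=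
  {C | ∀ i : Fin d, (i.castSucc, 1) ∈ C → (i.castSucc, -1) ∉ C}

theorem hasUniqueWeights_crossFamily :
    HasUniqueWeights (crossVertex (d := d + 1)) (crossFamily d) := by
  intro C hC D hD μ ν hμ hν hsum hvec
  have hdiff : ∀ i, μ (i, 1) - μ (i, -1) = ν (i, 1) - ν (i, -1) := fun i => by
    rw [← sum_smul_crossVertex, hvec, sum_smul_crossVertex]
  have hzero : ∀ {C : Finset (Fin (d + 1) × ℤˣ)} {ρ : Fin (d + 1) × ℤˣ → ℝ}, C ∈ crossFamily d →
      IsWeightOn C ρ → ∀ i : Fin d, ρ (i.castSucc, 1) = 0 ∨ ρ (i.castSucc, -1) = 0 :=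
    fun hC hρ i => or_iff_not_imp_left.2 fun h => hρ.eq_zero _ (hC i (hρ.mem h))
  have hcast : ∀ i : Fin d, μ (i.castSucc, 1) = ν (i.castSucc, 1) ∧
      μ (i.castSucc, -1) = ν (i.castSucc, -1) := fun i => by
    have hμ1 : 0 ≤ μ (i.castSucc, 1) := hμ.nonneg _
    have hμ2 : 0 ≤ μ (i.castSucc, -1) := hμ.nonneg _
    have hν1 : 0 ≤ ν (i.castSucc, 1) := hν.nonneg _
    have hν2 : 0 ≤ ν (i.castSucc, -1) := hν.nonneg _
    have := hdiff i.castSucc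
    rcases hzero hC hμ i with h | h <;> rcases hzero hD hν i with h' | h' <;>
      constructor <;> linarith
  rw [sum_prod_units, sum_prod_units, Fin.sum_univ_castSucc, Fin.sum_univ_castSucc,
    sum_congr rfl fun i _ => by rw [(hcast i).1, (hcast i).2]] at hsum
  have hlast := hdiff (Fin.last d)
  funext ⟨i, s⟩
  rcases Int.units_eq_one_or s with rfl | rfl <;> induction i using Fin.lastCases
  exacts [by linarith, (hcast _).1, by linarith, (hcast _).2]

/-- The weights that represent `x`: the positive and negative parts of its coordinates, with the
remaining mass `1 - ∑ |x_i|` shared equally by the two opposite vertices on the last axis. -/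
noncomputable def crossWeight (x : Fin (d + 1) → ℝ) (q : Fin (d + 1) × ℤˣ) : ℝ :=
  (((q.2 : ℤ) : ℝ) * x q.1)⁺ + if q.1 = Fin.last d then (1 - ∑ i, |x i|) / 2 else 0

theorem crossWeight_one (x : Fin (d + 1) → ℝ) (i : Fin (d + 1)) : crossWeight x (i, 1) =
    (x i)⁺ + if i = Fin.last d then (1 - ∑ i, |x i|) / 2 else 0 := by
  simp [crossWeight]

theorem crossWeight_neg_one (x : Fin (d + 1) → ℝ) (i : Fin (d + 1)) : crossWeight x (i, -1) =
    (x i)⁻ + if i = Fin.last d then (1 - ∑ i, |x i|) / 2 else 0 := by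
  simp [crossWeight]

theorem sum_crossWeight (x : Fin (d + 1) → ℝ) : ∑ q, crossWeight x q = 1 := by
  have hpair : ∀ i, crossWeight x (i, 1) + crossWeight x (i, -1) =
      |x i| + if i = Fin.last d then 1 - ∑ i, |x i| else 0 := fun i => by
    rw [crossWeight_one, crossWeight_neg_one, ← posPart_add_negPart (x i)]
    split_ifs <;> ring
  rw [sum_prod_units, sum_congr rfl fun i _ => hpair i, sum_add_distrib]
  simp

theorem sum_crossWeight_smul_crossVertex (x : Fin (d + 1) → ℝ) :
    ∑ q, crossWeight x q • crossVertex q = x := by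
  funext i
  rw [sum_smul_crossVertex, crossWeight_one, crossWeight_neg_one, add_sub_add_right_eq_sub,
    posPart_sub_negPart]

theorem crossWeight_nonneg {x : Fin (d + 1) → ℝ} (hx : ∑ i, |x i| ≤ 1) : 0 ≤ crossWeight x := by
  intro q
  have hrest : 0 ≤ (1 - ∑ i, |x i|) / 2 := by linarith
  exact add_nonneg (posPart_nonneg _) (by split_ifs <;> simp [hrest])

theorem mem_crossPolytope_iff {x : Fin (d + 1) → ℝ} :
    x ∈ crossPolytope (d + 1) ↔ ∑ i, |x i| ≤ 1 := by
  refine ⟨sum_abs_le_one_of_mem_crossPolytope, fun hx => ?_⟩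
  rw [crossPolytope_eq_convexHull]
  exact mem_convexHull_range_iff.2 ⟨crossWeight x, crossWeight_nonneg hx, sum_crossWeight x,
    sum_crossWeight_smul_crossVertex x⟩

theorem filter_crossWeight_ne_zero_mem_crossFamily (x : Fin (d + 1) → ℝ) :
    ({q | crossWeight x q ≠ 0} : Finset _) ∈ crossFamily d := by
  intro i
  simp only [mem_filter, mem_univ, true_and, not_not, crossWeight_one, crossWeight_neg_one,
    (Fin.castSucc_lt_last i).ne, if_false, add_zero]
  exact fun h => (le_total 0 (x i.castSucc)).elim negPart_eq_zero.2
    fun hx => absurd (posPart_eq_zero.2 hx) h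

theorem isTriangulationFamily_crossFamily :
    IsTriangulationFamily (crossVertex (d := d + 1)) (crossFamily d) where
  isLowerSet _ _ hDC hC i h := fun h' => hC i (hDC h) (hDC h')
  singleton_mem q i := by
    rw [mem_singleton, mem_singleton]
    rintro rfl h
    simp at h
  hasUniqueWeights := hasUniqueWeights_crossFamily
  exists_weight x hx := by
    rw [← crossPolytope_eq_convexHull, mem_crossPolytope_iff] at hx
    exact ⟨_, filter_crossWeight_ne_zero_mem_crossFamily x, crossWeight x,
      ⟨crossWeight_nonneg hx, fun q hq => by simpa using hq⟩, sum_crossWeight x,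
      sum_crossWeight_smul_crossVertex x⟩

/-- The linear form `∑ (i + 1) x_i`, from which the apexes of the faces are chosen. The last axis
has the largest coefficient, so every face that contains two opposite vertices has its apex
there. -/
noncomputable def crossForm (d : ℕ) : (Fin d → ℝ) →ₗ[ℝ] ℝ :=
  ∑ i : Fin d, ((i : ℝ) + 1) • LinearMap.proj i

theorem crossForm_crossVertex (q : Fin d × ℤˣ) :
    crossForm d (crossVertex q) = ((q.2 : ℤ) : ℝ) * ((q.1 : ℝ) + 1) := by
  simp [crossForm, crossVertex, LinearMap.sum_apply, Pi.single_apply, mul_comm]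

theorem injective_crossForm_crossVertex : Function.Injective (crossForm d ∘ crossVertex) := by
  rintro ⟨i, s⟩ ⟨j, t⟩ h
  simp only [Function.comp_apply, crossForm_crossVertex] at h
  norm_cast at h
  rcases Int.units_eq_one_or s with rfl | rfl <;> rcases Int.units_eq_one_or t with rfl | rfl <;>
    simp only [Units.val_one, Units.val_neg] at h <;>
    simp only [Prod.mk.injEq, Fin.ext_iff] <;> lia

theorem insert_mem_crossFamily {F : Set (Fin (d + 1) → ℝ)} (hF : IsFace (crossPolytope (d + 1)) F)
    {q : Fin (d + 1) × ℤˣ} (hq : IsMinVertex crossVertex (crossForm (d + 1)) F q)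
    {C : Finset (Fin (d + 1) × ℤˣ)} (hC : C ∈ crossFamily d) (hCF : ∀ p ∈ C, crossVertex p ∈ F) :
    insert q C ∈ crossFamily d := by
  have hopp : ∀ (i : Fin d) (s : ℤˣ), q = (i.castSucc, s) → (i.castSucc, -s) ∉ C := by
    rintro i s rfl hs
    have hsum : crossVertex (Fin.last d, -1) + crossVertex (Fin.last d, 1) =
        crossVertex (i.castSucc, s) + crossVertex (i.castSucc, -s) := by
      simp [crossVertex, ← Pi.single_add]
    have hlast : crossVertex (Fin.last d, -1) ∈ F :=
      hF.mem_of_add_eq_add (crossVertex_mem_crossPolytope _) (crossVertex_mem_crossPolytope _)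
        hq.1 (hCF _ hs) hsum
    have hlt := hq.2 _ hlast (by simp [Fin.ext_iff, i.2.ne'])
    rw [crossForm_crossVertex, crossForm_crossVertex] at hlt
    norm_cast at hlt
    have hid := i.2
    rcases Int.units_eq_one_or s with rfl | rfl <;> simp at hlt <;> lia
  intro i hi hi'
  rcases mem_insert.1 hi with h | h <;> rcases mem_insert.1 hi' with h' | h'
  · simpa using h.trans h'.symm
  · exact hopp i 1 h.symm h'
  · exact hopp i (-1) h'.symm (by simpa using h)
  · exact hC i h h'

/-- The indices of the vertices of `crossSimplex a`. -/
def crossIndices (a : Fin d → ℤˣ) : Finset (Fin (d + 1) × ℤˣ) :=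
  {(Fin.last d, 1), (Fin.last d, -1)} ∪ univ.image fun i => (i.castSucc, a i)

theorem image_crossIndices (a : Fin d → ℤˣ) :
    (crossIndices a).image crossVertex = crossSimplex a := by
  rw [crossIndices, crossSimplex, image_union, image_insert, image_singleton, image_image]
  simp [crossVertex, Pi.single_neg, Function.comp_def]

theorem mem_crossIndices {a : Fin d → ℤˣ} {q : Fin (d + 1) × ℤˣ} :
    q ∈ crossIndices a ↔ ∀ i : Fin d, q.1 = i.castSucc → q.2 = a i := by
  obtain ⟨j, s⟩ := q
  induction j using Fin.lastCases with
  | last =>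
    rcases Int.units_eq_one_or s with rfl | rfl <;>
      simpa [crossIndices, Fin.ext_iff] using fun (i : Fin d) hi => (i.2.ne' hi).elim
  | cast j => simp [crossIndices, (Fin.castSucc_lt_last j).ne, eq_comm]

theorem maximal_crossFamily_iff {C : Finset (Fin (d + 1) × ℤˣ)} :
    Maximal (· ∈ crossFamily d) C ↔ ∃ a, C = crossIndices a := by
  have hsub : ∀ C ∈ crossFamily d,
      C ⊆ crossIndices fun i => if (i.castSucc, 1) ∈ C then 1 else -1 := by
    rintro C hC ⟨j, s⟩ hq
    rw [mem_crossIndices]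
    rintro i rfl
    rcases Int.units_eq_one_or s with rfl | rfl
    · exact (if_pos hq).symm
    · exact (if_neg fun h => hC i h hq).symm
  have hmem : ∀ a : Fin d → ℤˣ, crossIndices a ∈ crossFamily d := fun a i h h' =>
    absurd ((mem_crossIndices.1 h i rfl).trans (mem_crossIndices.1 h' i rfl).symm) (by simp)
  constructor
  · exact fun hC => ⟨_, (hsub C hC.1).antisymm (hC.2 (hmem _) (hsub C hC.1))⟩
  · rintro ⟨a, rfl⟩
    refine ⟨hmem a, ?_⟩
    rintro D hD haD ⟨j, s⟩ hq
    rw [mem_crossIndices]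
    rintro i rfl
    have hai : (i.castSucc, a i) ∈ D := haD (mem_crossIndices.2 fun k hk => by
      rw [Fin.castSucc_injective d hk])
    by_contra hne
    rcases Int.units_eq_one_or s with rfl | rfl
    · exact hD i hq (Int.units_ne_iff_eq_neg.1 (Ne.symm hne) ▸ hai)
    · exact hD i (neg_neg (1 : ℤˣ) ▸ Int.units_ne_iff_eq_neg.1 (Ne.symm hne) ▸ hai) hq

theorem exists_isPointedTriangulation_crossPolytope (d : ℕ) :
    ∃ V K, IsPointedTriangulation (crossPolytope (d + 1)) V K ∧
      K.facets = {s | ∃ a : Fin d → ℤˣ, s = crossSimplex a} := by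
  have hfam := isTriangulationFamily_crossFamily (d := d)
  obtain ⟨V, hV⟩ := hfam.exists_isPointedTriangulation injective_crossForm_crossVertex
    fun F hF q hq C hC hCF =>
      insert_mem_crossFamily (crossPolytope_eq_convexHull ▸ hF) hq hC hCF
  refine ⟨V, hfam.complex, crossPolytope_eq_convexHull ▸ hV, ?_⟩
  rw [hfam.facets_complex]
  ext s
  constructor
  · rintro ⟨C, hC, -, rfl⟩
    obtain ⟨a, rfl⟩ := maximal_crossFamily_iff.1 hC
    exact ⟨a, image_crossIndices a⟩
  · rintro ⟨a, rfl⟩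
    exact ⟨_, maximal_crossFamily_iff.2 ⟨a, rfl⟩,
      ⟨(Fin.last d, 1), by simp [crossIndices]⟩, image_crossIndices a⟩

end CrossTriangulation

section SignVectorSums

variable {d : ℕ}

/-- The set of indices of the nonzero entries of a sign vector. -/
def signSupport (f : Fin d → SignType) : Finset (Fin d) := {i | f i ≠ 0}

theorem signSupport_nonempty_iff {f : Fin d → SignType} : (signSupport f).Nonempty ↔ f ≠ 0 := by
  simp [signSupport, filter_nonempty_iff, Function.ne_iff]

theorem card_signSupport_insertNth (p : Fin (d + 1)) (c : SignType) (g : Fin d → SignType) :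
    #(signSupport (p.insertNth c g : Fin (d + 1) → SignType)) =
      #(signSupport g) + if c = 0 then 0 else 1 := by
  simp only [signSupport, card_filter, Fin.sum_univ_succAbove _ p, Fin.insertNth_apply_same,
    Fin.insertNth_apply_succAbove, ite_not, add_comm]

theorem sum_signVector_succ (p : Fin (d + 1)) (φ : (Fin (d + 1) → SignType) → ℕ) :
    ∑ f, φ f = ∑ g : Fin d → SignType,
      (φ (p.insertNth 0 g) + φ (p.insertNth 1 g) + φ (p.insertNth (-1) g)) := by
  rw [← (Fin.insertNthEquiv (fun _ => SignType) p).sum_comp, Fintype.sum_prod_type_right]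
  refine sum_congr rfl fun g _ => ?_
  rw [SignType.univ_eq, sum_insert (by decide), sum_pair (by decide), ← add_assoc, add_right_comm]
  rfl

theorem sum_ne_choose_card_signSupport_sub_one (p : Fin (d + 1)) {s : SignType} (hs : s ≠ 0)
    (m : ℕ) : ∑ f : Fin (d + 1) → SignType with f ≠ 0 ∧ f p ≠ s, m.choose (#(signSupport f) - 1) =
      ∑ g : Fin d → SignType, (m + 1).choose #(signSupport g) := by
  rw [sum_filter, sum_signVector_succ p]
  refine sum_congr rfl fun g _ => ?_
  simp only [← signSupport_nonempty_iff, ← card_pos, card_signSupport_insertNth,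
    Fin.insertNth_apply_same]
  rcases s with _ | _ | _
  · exact absurd rfl hs
  all_goals rcases #(signSupport g) with _ | k <;> simp [Nat.choose_succ_succ]

theorem sum_choose_card_signSupport_succ (d m : ℕ) :
    ∑ f : Fin (d + 1) → SignType, (m + 1).choose #(signSupport f) =
      ∑ f : Fin (d + 1) → SignType, m.choose #(signSupport f) +
        ∑ g : Fin d → SignType, (m + 1).choose #(signSupport g) +
          ∑ g : Fin d → SignType, m.choose #(signSupport g) := by
  rw [sum_signVector_succ 0, sum_signVector_succ 0, ← sum_add_distrib, ← sum_add_distrib]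
  refine sum_congr rfl fun g _ => ?_
  simp only [card_signSupport_insertNth, if_true, add_zero, one_ne_zero, if_false,
    (by decide : (-1 : SignType) ≠ 0), Nat.choose_succ_succ m]
  ring

theorem sum_choose_mul_multichoose_succ (d m : ℕ) :
    ∑ i ∈ range (d + 2), (d + 1).choose i * (m + 1 + 1 - i).multichoose (d + 1) =
      ∑ i ∈ range (d + 2), (d + 1).choose i * (m + 1 - i).multichoose (d + 1) +
        ∑ i ∈ range (d + 1), d.choose i * (m + 1 + 1 - i).multichoose d +
          ∑ i ∈ range (d + 1), d.choose i * (m + 1 - i).multichoose d := by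
  have hstep : ∀ i ∈ range (d + 2), (m + 1 + 1 - i).multichoose (d + 1) =
      (m + 1 - i).multichoose (d + 1) + (m + 1 + 1 - i).multichoose d := fun i hi =>
    multichoose_sub_succ (by have := mem_range.1 hi; lia)
  have hpascal := sum_choose_succ_mul (fun i _ => (m + 1 + 1 - i).multichoose d) d
  simp only [Nat.cast_id, Nat.add_sub_add_right] at hpascal
  rw [sum_congr rfl fun i hi => by rw [hstep i hi], add_assoc (∑ _ ∈ _, _), ← hpascal,
    ← sum_add_distrib]
  exact sum_congr rfl fun i _ => mul_add _ _ _

/-- Both sides are the Delannoy numbers, which satisfy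
`D(d + 1, m + 1) = D(d + 1, m) + D(d, m + 1) + D(d, m)`. -/
theorem sum_choose_card_signSupport (d m : ℕ) :
    ∑ f : Fin d → SignType, m.choose #(signSupport f) =
      ∑ i ∈ range (d + 1), d.choose i * (m + 1 - i).multichoose d := by
  induction d generalizing m with
  | zero => simp [signSupport]
  | succ d ihd =>
    induction m with
    | zero =>
      rw [sum_eq_single 0 (fun f _ hf => Nat.choose_eq_zero_of_lt
        (card_pos.2 (signSupport_nonempty_iff.2 hf))) (by simp), sum_range_succ']
      simp [signSupport]
    | succ m ihm =>
      rw [sum_choose_card_signSupport_succ, sum_choose_mul_multichoose_succ, ihm, ihd, ihd]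

end SignVectorSums

section CrossFaces

variable {d : ℕ}

theorem sign_cast_mul_self {s : SignType} (hs : s ≠ 0) : (s : ℝ) * s = 1 := by
  rcases s with _ | _ | _
  · exact absurd rfl hs
  all_goals simp

theorem abs_sign_cast {s : SignType} (hs : s ≠ 0) : |(s : ℝ)| = 1 := by
  rcases s with _ | _ | _
  · exact absurd rfl hs
  all_goals simp

/-- The simplex with vertices `f i • e_i`, where `i` ranges over the support of `f`. -/
def crossFace (f : Fin d → SignType) : Set (Fin d → ℝ) :=
  {x | (∀ i, f i * x i = |x i|) ∧ ∑ i, |x i| = 1}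

theorem single_mem_crossFace_iff {f : Fin d → SignType} {i : Fin d} {s : SignType} (hs : s ≠ 0) :
    Pi.single i (s : ℝ) ∈ crossFace f ↔ f i = s := by
  have habs : ∀ k, |(Pi.single i (s : ℝ) : Fin d → ℝ) k| = if k = i then 1 else 0 := fun k => by
    rw [Pi.single_apply]
    split_ifs <;> simp [abs_sign_cast hs]
  have hmem : Pi.single i (s : ℝ) ∈ crossFace f ↔ (f i : ℝ) * s = 1 := by
    simp only [crossFace, habs, sum_ite_eq', mem_univ, if_true, and_true, Set.mem_ofPred_eq]
    refine ⟨fun h => by simpa using h i, fun h k => ?_⟩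
    split_ifs with hk
    · rw [hk, Pi.single_eq_same, h]
    · rw [Pi.single_eq_of_ne hk, mul_zero]
  rw [hmem]
  generalize f i = t
  rcases s with _ | _ | _
  · exact absurd rfl hs
  all_goals rcases t with _ | _ | _ <;> norm_num <;> decide

theorem injective_crossFace : Function.Injective (crossFace (d := d)) := by
  intro f g h
  funext i
  have hiff : ∀ s : SignType, s ≠ 0 → (f i = s ↔ g i = s) := fun s hs => by
    rw [← single_mem_crossFace_iff hs, h, single_mem_crossFace_iff hs]
  by_cases hf : f i = 0
  · by_contra hne
    exact hne ((hiff (g i) fun hg => hne (hf.trans hg.symm)).2 rfl)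
  · exact ((hiff (f i) hf).1 rfl).symm

theorem crossFace_nonempty {f : Fin d → SignType} (hf : f ≠ 0) : (crossFace f).Nonempty := by
  obtain ⟨i, hi⟩ := Function.ne_iff.1 hf
  exact ⟨_, (single_mem_crossFace_iff hi).2 rfl⟩

theorem mul_eq_mul_abs_iff {g M : ℝ} {s : SignType} (hM : 0 < M) (hs : s ≠ 0 → g = M * s)
    (hs0 : s = 0 → |g| < M) (x : ℝ) : g * x = M * |x| ↔ s * x = |x| := by
  by_cases h : s = 0
  · rw [h, SignType.coe_zero, zero_mul, eq_comm (a := (0 : ℝ)), abs_eq_zero]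
    refine ⟨fun hx => ?_, fun hx => by simp [hx]⟩
    by_contra hne
    refine (mul_lt_mul_of_pos_right (hs0 h) (abs_pos.2 hne)).not_ge ?_
    rw [← hx, ← abs_mul]
    exact le_abs_self _
  · rw [hs h, mul_assoc, mul_right_inj' hM.ne']

theorem abs_le_of_eq_mul_sign {g M : ℝ} {s : SignType} (hM : 0 < M) (hs : s ≠ 0 → g = M * s)
    (hs0 : s = 0 → |g| < M) : |g| ≤ M := by
  by_cases h : s = 0
  · exact (hs0 h).le
  · rw [hs h, abs_mul, abs_sign_cast h, mul_one, abs_of_pos hM]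

theorem setOf_forall_le_eq_crossFace {g : Fin (d + 1) → ℝ} {M : ℝ} {f : Fin (d + 1) → SignType}
    (hM : 0 < M) (hf : f ≠ 0) (hfg : ∀ i, f i ≠ 0 → g i = M * f i)
    (hfg0 : ∀ i, f i = 0 → |g i| < M) :
    {x ∈ crossPolytope (d + 1) | ∀ y ∈ crossPolytope (d + 1), ∑ i, g i * y i ≤ ∑ i, g i * x i} =
      crossFace f := by
  have hle : ∀ x : Fin (d + 1) → ℝ, ∀ i ∈ univ, g i * x i ≤ M * |x i| := fun x i _ => by
    refine (le_abs_self _).trans ?_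
    rw [abs_mul]
    exact mul_le_mul_of_nonneg_right (abs_le_of_eq_mul_sign hM (hfg i) (hfg0 i)) (abs_nonneg _)
  have hiff := fun i => mul_eq_mul_abs_iff hM (hfg i) (hfg0 i)
  have hface : ∀ x ∈ crossFace f, x ∈ crossPolytope (d + 1) ∧ ∑ i, g i * x i = M := fun x hx => by
    rw [mem_crossPolytope_iff, sum_congr rfl fun i _ => (hiff i _).2 (hx.1 i), ← mul_sum, hx.2]
    exact ⟨le_rfl, mul_one M⟩
  have hbound : ∀ x ∈ crossPolytope (d + 1), M * ∑ i, |x i| ≤ M := fun x hx =>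
    mul_le_of_le_one_right hM.le (mem_crossPolytope_iff.1 hx)
  have hgreatest : IsGreatest ((fun x => ∑ i, g i * x i) '' crossPolytope (d + 1)) M := by
    obtain ⟨x, hx⟩ := crossFace_nonempty hf
    refine ⟨⟨x, hface x hx⟩, ?_⟩
    rintro _ ⟨x, hx, rfl⟩
    exact (sum_le_sum (hle x)).trans (by rw [← mul_sum]; exact hbound x hx)
  rw [setOf_forall_le_eq_of_isGreatest hgreatest]
  ext x
  refine ⟨fun ⟨hx, hxM⟩ => ?_, hface x⟩
  have hsum : M * ∑ i, |x i| = M := (hbound x hx).antisymm <| by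
    rw [mul_sum]
    exact hxM.ge.trans (sum_le_sum (hle x))
  refine ⟨fun i => (hiff i _).1 ((sum_eq_sum_iff_of_le (hle x)).1 ?_ i (mem_univ i)),
    (mul_eq_left₀ hM.ne').1 hsum⟩
  rw [← mul_sum, hsum]
  exact hxM

theorem isFace_crossFace {f : Fin (d + 1) → SignType} (hf : f ≠ 0) :
    IsFace (crossPolytope (d + 1)) (crossFace f) := by
  refine ⟨fun _ => ⟨∑ i, (f i : ℝ) • ContinuousLinearMap.proj i, ?_⟩, crossFace_nonempty hf⟩
  rw [← setOf_forall_le_eq_crossFace one_pos hf (fun i _ => (one_mul _).symm)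
    fun i hi => by simp [hi]]
  simp

theorem exists_crossFace_eq_of_isProperFace {F : Set (Fin (d + 1) → ℝ)}
    (hF : IsProperFace (crossPolytope (d + 1)) F) : ∃ f ≠ 0, crossFace f = F := by
  obtain ⟨⟨hexp, hne⟩, hF⟩ := hF
  obtain ⟨l, rfl⟩ := hexp hne
  let g : Fin (d + 1) → ℝ := fun i => l (Pi.single i 1)
  have hl : ∀ x, l x = ∑ i, g i * x i := fun x => by
    conv_lhs => rw [pi_eq_sum_univ' x]
    simp [g, mul_comm, map_sum]
  simp only [hl] at hF ⊢
  obtain ⟨p, -, hp⟩ := exists_max_image univ (fun i => |g i|) univ_nonempty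
  have hgp : g p ≠ 0 := fun hgp => hF <| by
    have hg : ∀ i, g i = 0 := fun i =>
      abs_nonpos_iff.1 ((hp i (mem_univ i)).trans (abs_nonpos_iff.2 hgp))
    simp [hg]
  let f : Fin (d + 1) → SignType := fun i => if |g i| = |g p| then SignType.sign (g i) else 0
  have hf : f ≠ 0 := fun h => by simpa [f, hgp] using congrFun h p
  refine ⟨f, hf, (setOf_forall_le_eq_crossFace (abs_pos.2 hgp) hf (fun i hi => ?_)
    fun i hi => ?_).symm⟩
  · have habs : |g i| = |g p| := by_contra fun h => hi (if_neg h)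
    simp only [f, if_pos habs]
    rw [← habs, abs_mul_sign]
  · refine (hp i (mem_univ i)).lt_of_ne fun habs => hgp ?_
    simp only [f, if_pos habs, sign_eq_zero_iff] at hi
    simpa [hi] using habs.symm

theorem bijOn_crossFace : Set.BijOn crossFace
    (({f | f ≠ 0} : Finset (Fin (d + 1) → SignType)) : Set (Fin (d + 1) → SignType))
    {F | IsProperFace (crossPolytope (d + 1)) F} := by
  refine ⟨fun f hf => ⟨isFace_crossFace (mem_filter.1 hf).2, fun h => ?_⟩,
    injective_crossFace.injOn, fun F hF => ?_⟩
  · have hzero : (0 : Fin (d + 1) → ℝ) ∈ crossFace f := h ▸ mem_crossPolytope_iff.2 (by simp)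
    simpa using hzero.2
  · obtain ⟨f, hf, rfl⟩ := exists_crossFace_eq_of_isProperFace hF
    exact ⟨f, by simpa using hf, rfl⟩

end CrossFaces

section CrossNumbers

variable {d : ℕ}

/-- The facet of the cross polytope in the orthant of the sign vector `s`, parametrized by a
standard simplex. -/
noncomputable def orthantParam {s : Fin d → SignType} (hs : ∀ i, s i ≠ 0) :
    SimplexProductParam (fun _ : Unit => Fin d) (Fin d → ℝ) where
  toLin := LinearMap.pi fun i => (s i : ℝ) •
    (LinearMap.proj (R := ℝ) (φ := fun _ => ℝ) i ∘ₗ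
      LinearMap.proj (R := ℝ) (φ := fun _ : Unit => Fin d → ℝ) ())
  coord _ k := (s k : ℝ) • ContinuousLinearMap.proj k
  off _ _ := 0
  coord_toLin c _ j k := by
    simp [← mul_assoc, sign_cast_mul_self (hs k)]

theorem orthantParam_face {s : Fin d → SignType} (hs : ∀ i, s i ≠ 0)
    (T : Unit → Finset (Fin d)) :
    (orthantParam hs).face T = crossFace fun i => if i ∈ T () then s i else 0 := by
  have happly : ∀ c i, (orthantParam hs).toLin c i = s i * c () i := fun _ _ => rfl
  ext x
  constructor
  · rintro ⟨c, hc, rfl⟩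
    have habs : ∀ i, |(orthantParam hs).toLin c i| = c () i := fun i => by
      rw [happly, abs_mul, abs_sign_cast (hs i), one_mul, abs_of_nonneg ((hc ()).1.1 i)]
    refine ⟨fun i => ?_, (sum_congr rfl fun i _ => habs i).trans (hc ()).1.2⟩
    rw [habs, happly]
    beta_reduce
    split_ifs with hi
    · rw [← mul_assoc, sign_cast_mul_self (hs i), one_mul]
    · rw [(hc ()).2 i hi, mul_zero, mul_zero]
  · rintro ⟨hsign, hsum⟩
    beta_reduce at hsign
    have hzero : ∀ i ∉ T (), x i = 0 := fun i hi => by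
      simpa [hi, eq_comm] using hsign i
    refine ⟨fun _ i => |x i|, fun _ => ⟨⟨fun i => abs_nonneg _, hsum⟩, fun i hi => ?_⟩, ?_⟩
    · exact abs_eq_zero.2 (hzero i hi)
    · funext i
      rw [happly]
      by_cases hi : i ∈ T ()
      · rw [← hsign, if_pos hi, ← mul_assoc, sign_cast_mul_self (hs i), one_mul]
      · rw [hzero i hi, abs_zero, mul_zero]

theorem interiorPolytopeNumber_crossFace {V : Set (Fin (d + 1) → ℝ) → Fin (d + 1) → ℝ}
    (hV : IsApexAssignment (crossPolytope (d + 1)) V) {f : Fin (d + 1) → SignType} (hf : f ≠ 0)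
    (n : ℕ) : interiorPolytopeNumber V (crossFace f) (n + 2) =
      (n.choose (#(signSupport f) - 1) : ℕ) := by
  let s : Fin (d + 1) → SignType := fun i => if f i = 0 then 1 else f i
  have hs : ∀ i, s i ≠ 0 := fun i => by
    simp only [s]
    split_ifs with h
    exacts [one_ne_zero, h]
  have hface : crossFace f = (orthantParam hs).face fun _ => signSupport f := by
    rw [orthantParam_face]
    congr 1
    funext i
    by_cases h : f i = 0 <;> simp [signSupport, s, h]
  have hVs : IsApexAssignment (orthantParam hs).polytope V := by
    intro F hF
    rw [← (orthantParam hs).face_univ] at hF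
    obtain ⟨T, -, hT, rfl⟩ := (orthantParam hs).exists_face_eq_of_isFace (fun _ => univ_nonempty) hF
    refine hV _ (orthantParam_face hs T ▸ isFace_crossFace fun h => ?_)
    obtain ⟨i, hi⟩ := hT ()
    exact hs i (by simpa [hi] using congrFun h i)
  rw [hface, (orthantParam hs).interiorPolytopeNumber_face hVs fun _ =>
    signSupport_nonempty_iff.2 hf]
  simp

theorem exists_apex_crossPolytope_eq_single {V : Set (Fin (d + 1) → ℝ) → Fin (d + 1) → ℝ}
    (hV : IsApexAssignment (crossPolytope (d + 1)) V) :
    ∃ i, ∃ s : SignType, s ≠ 0 ∧ V (crossPolytope (d + 1)) = Pi.single i (s : ℝ) := by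
  have hface : IsFace (crossPolytope (d + 1)) (crossPolytope (d + 1)) :=
    isFace_refl ⟨_, crossVertex_mem_crossPolytope (0, 1)⟩
  rcases extremePoints_convexHull_subset (hV _ hface) with ⟨i, hi⟩ | ⟨i, hi⟩
  · exact ⟨i, 1, by decide, hi.symm.trans (by simp)⟩
  · exact ⟨i, -1, by decide, hi.symm.trans (by simp [Pi.single_neg])⟩

theorem not_subsingleton_crossPolytope : ¬(crossPolytope (d + 1)).Subsingleton := fun h => by
  have := congrFun (h (crossVertex_mem_crossPolytope (0, 1))
    (crossVertex_mem_crossPolytope (0, -1))) 0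
  norm_num [crossVertex] at this

theorem polytopeNumber_crossPolytope_add_two {V : Set (Fin (d + 1) → ℝ) → Fin (d + 1) → ℝ}
    (hV : IsApexAssignment (crossPolytope (d + 1)) V) (n : ℕ) :
    polytopeNumber V (crossPolytope (d + 1)) (n + 2) =
      polytopeNumber V (crossPolytope (d + 1)) (n + 1) +
        (∑ i ∈ range (d + 1), d.choose i * (n + 2 - i).multichoose d : ℕ) := by
  classical
  obtain ⟨p, s, hs, hp⟩ := exists_apex_crossPolytope_eq_single hV
  rw [polytopeNumber_add_two_eq_sum V not_subsingleton_crossPolytope bijOn_crossFace,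
    filter_filter, hp, ← sum_choose_card_signSupport, ← sum_ne_choose_card_signSupport_sub_one p hs]
  simp only [single_mem_crossFace_iff hs]
  push_cast
  exact congrArg _ (sum_congr rfl fun f hf =>
    interiorPolytopeNumber_crossFace hV (mem_filter.1 hf).2.1 n)

theorem polytopeNumber_crossPolytope {V : Set (Fin (d + 1) → ℝ) → Fin (d + 1) → ℝ}
    (hV : IsApexAssignment (crossPolytope (d + 1)) V)
    {W : Set (Fin (d + 1 + 1) → ℝ) → Fin (d + 1 + 1) → ℝ}
    (hW : IsApexAssignment (stdSimplex ℝ (Fin (d + 1 + 1))) W) (n : ℕ) :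
    polytopeNumber V (crossPolytope (d + 1)) n = ∑ i ∈ range (d + 1),
      (d.choose i : ℤ) * polytopeNumber W (stdSimplex ℝ (Fin (d + 1 + 1))) (n - i) := by
  simp only [polytopeNumber_stdSimplex (Nat.le_add_left 1 d) hW]
  induction n using Nat.twoStepInduction with
  | zero => simp [polytopeNumber_zero]
  | one => simp [polytopeNumber_one, sum_range_succ']
  | more n _ ih =>
    rw [polytopeNumber_crossPolytope_add_two hV, ih, Nat.cast_sum, ← sum_add_distrib]
    refine sum_congr rfl fun i hi => ?_
    rw [multichoose_sub_succ (n := n + 1) (by have := mem_range.1 hi; lia)]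
    push_cast
    ring

end CrossNumbers

theorem mainTheorem11 :
    -- cross polytopes of dimension `d + 1 ≥ 1`
    (∀ d : ℕ,
      (∃ V K, IsPointedTriangulation (crossPolytope (d + 1)) V K ∧
        K.facets = {s | ∃ a : Fin d → ℤˣ, s = crossSimplex a}) ∧
      ∀ V, IsApexAssignment (crossPolytope (d + 1)) V →
      ∀ W, IsApexAssignment (stdSimplex ℝ (Fin (d + 1 + 1))) W →
      ∀ n : ℕ, polytopeNumber V (crossPolytope (d + 1)) n =
        ∑ i ∈ Finset.range (d + 1),
          (d.choose i : ℤ) * polytopeNumber W (stdSimplex ℝ (Fin (d + 1 + 1))) (n - i)) ∧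
    -- measure polytopes of dimension `d ≥ 1`
    (∀ d : ℕ, 1 ≤ d → ∀ a b : Fin d → ℝ, (∀ i, a i < b i) →
      (∃ V K, IsPointedTriangulation (measurePolytope a b) V K ∧
        K.facets = {s | ∃ σ : Equiv.Perm (Fin d), s = boxSimplex a b σ}) ∧
      ∀ V, IsApexAssignment (measurePolytope a b) V →
      ∀ W, IsApexAssignment (stdSimplex ℝ (Fin (d + 1))) W →
      ∀ n : ℕ, polytopeNumber V (measurePolytope a b) n =
        ∑ i ∈ Finset.range d,
          (eulerianNumber d i : ℤ) * polytopeNumber W (stdSimplex ℝ (Fin (d + 1))) (n - i)) ∧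
    -- products of simplices of total dimension `d_1 + ⋯ + d_l ≥ 1`
    (∀ (l : ℕ) (d : Fin l → ℕ), 1 ≤ ∑ j, d j →
      (∃ V K, IsPointedTriangulation (simplexProduct d) V K ∧
        K.facets = {s | ∃ w, IsMultisetPerm d w ∧ s = productSimplex d w}) ∧
      ∀ V, IsApexAssignment (simplexProduct d) V →
      ∀ W, IsApexAssignment (stdSimplex ℝ (Fin ((∑ j, d j) + 1))) W →
      ∀ n : ℕ, polytopeNumber V (simplexProduct d) n =
        ∑ i ∈ Finset.range (∑ j, d j),
          (generalizedEulerianNumber d i : ℤ) *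
            polytopeNumber W (stdSimplex ℝ (Fin ((∑ j, d j) + 1))) (n - i)) := by
  refine ⟨fun d => ⟨exists_isPointedTriangulation_crossPolytope d, fun V hV W hW n =>
      polytopeNumber_crossPolytope hV hW n⟩,
    fun d hd a b h => ⟨exists_isPointedTriangulation_measurePolytope hd h, fun V hV W hW n =>
      polytopeNumber_measurePolytope hd h hV hW n⟩,
    fun l d hd => ⟨exists_isPointedTriangulation_simplexProduct hd, fun V hV W hW n =>
      polytopeNumber_simplexProduct hd hV hW n⟩⟩
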